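/- Let $\mathcal T=\sum_{a=1}^{2}\gamma_a\,\mathbf w_a\otimes\mathbf u_a\otimes\mathbf v_a+\mathcal Z\in\mathbb R^{m_1\times m_2\times m_3}$, where $\gamma_a>0$, the $\mathbf w_a,\mathbf u_a,\mathbf v_a$ are unit vectors, $\mathbf u_1\otimes\mathbf v_1$ and $\mathbf u_2\otimes\mathbf v_2$ span different lines, and the entries of $\mathcal Z$ are independent standard normal variables. Let $J_1,J_2\subset\{1,\dots,m_1\}$ be the supports of $\mathbf w_1,\mathbf w_2$, and assume that they are disjoint, that $|J_1|=|J_2|=l$ and that $2l<m_1$. For a slice $T_i=\mathcal T(i,:,:)$ let $\lambda_i$ be the largest eigenvalue of $T_i^{t}T_i$ and $\tilde{\mathbf v}_i$ a corresponding unit eigenvector. Put $\lambda=\max_i\lambda_i$, $c_{ik}=\bigl|\langle \tfrac{\lambda_i}{\lambda}\tilde{\mathbf v}_i,\tfrac{\lambda_k}{\lambda}\tilde{\mathbf v}_k\rangle\bigr|$ and $d_i=\sum_{k=1}^{m_1}c_{ik}$. For $\epsilon>0$, a set $J$ of indices is a slice cluster (at threshold $\epsilon$) if $c_{ik}\ge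 1-\epsilon/2$ for all $i,k\in J$ (including $i=k$, so that $\lambda_i\approx\lambda$ for $i\in J$). The MSC algorithm with threshold $\epsilon$ sorts the numbers $d_i$, starts from the set $J$ of the indices that lie above a largest gap between consecutive sorted values, and then, as long as some pair $i,n\in J$ violates $$|d_i-d_n|\le |J|\,\frac{\epsilon}{2}+\sqrt{\log(m_1-|J|)},$$ removes from $J$ an index with the smallest $d_i$ among those that occur in a violating pair. Its output is the final set $J$. Then for all constants $\kappa,c>0$ there is a constant $c_1>0$, depending only on $\kappa$ and $c$, such that the following holds whenever $m_2,m_3\le\kappa m_1$ and $\sqrt\epsilon\le\frac1{m_1-l}$. With probability at least $1-e\,(m_1-2l)^{-c_1}$, for every choice of the unit top eigenvectors: if $J_1$ and $J_2$ are slice clusters at threshold $\epsilon$ and $\lambda\ge c\,m_1$, then $$|d_i-d_n|\le 2l\,\frac{\epsilon}{2}+\sqrt{\log(m_1-2l)}\qquad\text{for all } i,n\in J_1\cup J_2,$$ and the output of the MSC algorithm is $J_1\cup J_2$, however ties are broken in it. -/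

import Mathlib

open MeasureTheory ProbabilityTheory

/-- A real third-order tensor of size `m₁ × m₂ × m₃`, given by its mode-1 slices
(`T k` is the slice `T(k,:,:)`). -/
abbrev Tensor3 (m₁ m₂ m₃ : ℕ) : Type := Fin m₁ → Matrix (Fin m₂) (Fin m₃) ℝ

section Spectral

variable {m₁ m₂ m₃ : ℕ}

/-- The signal tensor `∑ a, γ a • (w a ⊗ u a ⊗ v a)`. -/
def signalTensor {r : ℕ} (γ : Fin r → ℝ) (w : Fin r → EuclideanSpace ℝ (Fin m₁))
    (u : Fin r → EuclideanSpace ℝ (Fin m₂)) (v : Fin r → EuclideanSpace ℝ (Fin m₃)) :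
    Tensor3 m₁ m₂ m₃ :=
  fun k i j => ∑ a, γ a * w a k * u a i * v a j

/-- The line of `m₂ × m₃` matrices spanned by `u ⊗ v`: the slices of the signal
`γ • (w ⊗ u ⊗ v)` all lie in it. -/
def sliceSubspace (u : EuclideanSpace ℝ (Fin m₂)) (v : EuclideanSpace ℝ (Fin m₃)) :
    Submodule ℝ (Matrix (Fin m₂) (Fin m₃) ℝ) :=
  Submodule.span ℝ {Matrix.of fun i j => u i * v j}

/-- The slice covariance matrix `C_k = T_kᵗ T_k`. -/
def sliceCov (T : Tensor3 m₁ m₂ m₃) (k : Fin m₁) : Matrix (Fin m₃) (Fin m₃) ℝ :=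
  (T k).transpose * T k

theorem sliceCov_isHermitian (T : Tensor3 m₁ m₂ m₃) (k : Fin m₁) :
    (sliceCov T k).IsHermitian := by
  simp [sliceCov, Matrix.IsHermitian, Matrix.conjTranspose_eq_transpose_of_trivial,
    Matrix.transpose_mul]

/-- The top eigenvalue of the `k`-th slice covariance matrix. -/
noncomputable def topEigenvalue (T : Tensor3 m₁ m₂ m₃) (k : Fin m₁) : ℝ :=
  ⨆ j, (sliceCov_isHermitian T k).eigenvalues j

/-- `λ`, the largest of the top eigenvalues of all slices. -/
noncomputable def maxTopEigenvalue (T : Tensor3 m₁ m₂ m₃) : ℝ :=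
  ⨆ k, topEigenvalue T k

/-- `x k` is a unit top eigenvector of the `k`-th slice covariance matrix, for every `k`. -/
def IsTopEigenvectors (T : Tensor3 m₁ m₂ m₃) (x : Fin m₁ → EuclideanSpace ℝ (Fin m₃)) : Prop :=
  ∀ k, ‖x k‖ = 1 ∧ (sliceCov T k).mulVec (x k) = fun j => topEigenvalue T k * x k j

/-- The matrix `V`, whose `k`-th column is the top eigenvector `x k` scaled by the `k`-th
top eigenvalue divided by `λ`. -/
noncomputable def dispersionMatrix (T : Tensor3 m₁ m₂ m₃)
    (x : Fin m₁ → EuclideanSpace ℝ (Fin m₃)) : Matrix (Fin m₃) (Fin m₁) ℝ :=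
  Matrix.of fun j k => topEigenvalue T k / maxTopEigenvalue T * x k j

/-- The similarity matrix `C = |Vᵗ V|` (entrywise absolute value). -/
noncomputable def similarityMatrix (T : Tensor3 m₁ m₂ m₃)
    (x : Fin m₁ → EuclideanSpace ℝ (Fin m₃)) : Matrix (Fin m₁) (Fin m₁) ℝ :=
  ((dispersionMatrix T x).transpose * dispersionMatrix T x).map (fun t => |t|)

/-- The marginal sums `d_i` of the rows of the similarity matrix. -/
noncomputable def marginalSum (T : Tensor3 m₁ m₂ m₃)
    (x : Fin m₁ → EuclideanSpace ℝ (Fin m₃)) (i : Fin m₁) : ℝ :=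
  ∑ k, similarityMatrix T x i k

/-- The slices indexed by `J` form a cluster at threshold `ε`: any two of them are
`ε`-similar, `c_{ik} ≥ 1 - ε / 2`. The diagonal case `i = k` says that the top eigenvalue of
each of these slices agrees with `λ` up to the factor `√(1 - ε / 2)`. -/
def IsSliceCluster (T : Tensor3 m₁ m₂ m₃) (x : Fin m₁ → EuclideanSpace ℝ (Fin m₃)) (ε : ℝ)
    (J : Finset (Fin m₁)) : Prop :=
  ∀ i ∈ J, ∀ k ∈ J, 1 - ε / 2 ≤ similarityMatrix T x i k

end Spectral

section Algorithm

variable {m : ℕ}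

/-- The bound `n ε / 2 + √(log (m - n))` on the differences of marginal sums within a cluster of
`n` out of `m` slices. -/
noncomputable def mscBound (m : ℕ) (ε : ℝ) (n : ℕ) : ℝ :=
  n * (ε / 2) + √(Real.log ((m : ℝ) - n))

/-- Initialization: sort `d` increasingly, cut at a position `p` of the largest gap between
consecutive sorted values, and keep the indices above the gap. -/
def IsMSCInit (d : Fin m → ℝ) (J : Finset (Fin m)) : Prop :=
  ∃ σ : Equiv.Perm (Fin m), Monotone (d ∘ σ) ∧ ∃ (p : ℕ) (hp : p + 1 < m),
    (∀ (q : ℕ) (hq : q + 1 < m),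
      d (σ ⟨q + 1, hq⟩) - d (σ ⟨q, by omega⟩) ≤ d (σ ⟨p + 1, hp⟩) - d (σ ⟨p, by omega⟩)) ∧
    ∀ i, i ∈ J ↔ p < (σ.symm i : ℕ)

/-- The index `i` of `J` violates the bound within `J`. -/
def MSCViolates (d : Fin m → ℝ) (ε : ℝ) (J : Finset (Fin m)) (i : Fin m) : Prop :=
  i ∈ J ∧ ∃ n ∈ J, mscBound m ε J.card < |d i - d n|

/-- One pass of the loop: exclude from `J` a violating index with the smallest `d`. -/
def MSCStep (d : Fin m → ℝ) (ε : ℝ) (J J' : Finset (Fin m)) : Prop :=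
  ∃ i, MSCViolates d ε J i ∧ (∀ i', MSCViolates d ε J i' → d i ≤ d i') ∧ J' = J.erase i

/-- `J` is an output of the multi-slice clustering procedure with marginal sums `d` and
threshold `ε`: it is reached from an initialization by the loop, and no index violates
the bound any more. -/
def IsMSCOutput (d : Fin m → ℝ) (ε : ℝ) (J : Finset (Fin m)) : Prop :=
  ∃ J₀, IsMSCInit d J₀ ∧ Relation.ReflTransGen (MSCStep d ε) J₀ J ∧
    ∀ i, ¬ MSCViolates d ε J i

end Algorithm

/-! Write N = m₁ - 2l, t = N^(1/8), and y_k for the scaled top eigenvectors.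

Deterministic half (`isMSCOutput_iff_of_sum_topEigenvalue_le`). Within a cluster the y_k agree up to
sign and an error √ε, so every d_i on J₁ ∪ J₂ is close to D = l + l|⟨y_p, y_q⟩| with p ∈ J₁, q ∈ J₂.
The value D serves both clusters because they have equal size, and the error is of order l√ε ≤ 1
because l ≤ m₁ - l. If the top eigenvalues of the noise slices add up to at most λ/20, their
contribution to these d_i is at most 1/20, while d_i is below l/4 off the clusters. The largest gap
then cuts out J₁ ∪ J₂ and the loop never runs.

Probabilistic half (`exists_exceptional_set`). The noise eigenvalues sum to at most the squared
Frobenius norm of the noise, of order N m₂ m₃, which λ ≥ c m₁ alone does not dominate. The cluster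
hypothesis itself supplies the missing size of λ: it forces the norms of a slice i ∈ J₁ and a slice
n ∈ J₂ to have logarithms within ε ≤ (m₁ - l)⁻². The norm of slice i is homogeneous in the entries
of that slice, and slice n does not involve them, so such a coincidence is improbable
(`measureReal_abs_log_sub_log_le`) unless the signal in slice i is large; and then λ is large as
well.

The anti-concentration comes from rescaling. Contracting slice i by the factors e^(-3hj), j < K,
moves the event of a coincidence within h to K disjoint events, and each has Gaussian measure
comparable to the original one as long as the contraction is weak. -/

/-! ### Top eigenvalues as squared operator norms -/

section SpectralNorm

open scoped Matrix.Norms.L2Operator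

variable {m₁ m₂ m₃ : ℕ}

theorem Matrix.IsHermitian.l2_opNorm_eq_norm_eigenvalues {n : Type*} [Fintype n] [DecidableEq n]
    {A : Matrix n n ℝ} (hA : A.IsHermitian) : ‖A‖ = ‖hA.eigenvalues‖ := by
  conv_lhs => rw [hA.spectral_theorem]
  rw [Unitary.conjStarAlgAut_apply, ← Unitary.coe_star, CStarRing.norm_mul_coe_unitary,
    CStarRing.norm_coe_unitary_mul, Matrix.l2_opNorm_diagonal]
  rfl

theorem sliceCov_eigenvalues_nonneg (T : Tensor3 m₁ m₂ m₃) (k : Fin m₁) (j : Fin m₃) :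
    0 ≤ (sliceCov_isHermitian T k).eigenvalues j := by
  have h : (sliceCov T k).PosSemidef := by
    have := Matrix.posSemidef_conjTranspose_mul_self (T k)
    rwa [Matrix.conjTranspose_eq_transpose_of_trivial] at this
  exact h.eigenvalues_nonneg j

/-- Passing to the operator norm makes the homogeneity in the entries of the slice visible, which
the scaling argument needs. -/
theorem topEigenvalue_eq_norm_sq [NeZero m₃] (T : Tensor3 m₁ m₂ m₃) (k : Fin m₁) :
    topEigenvalue T k = ‖T k‖ ^ 2 := by
  have h := Matrix.l2_opNorm_conjTranspose_mul_self (T k)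
  rw [Matrix.conjTranspose_eq_transpose_of_trivial] at h
  rw [sq, ← h]
  change _ = ‖sliceCov T k‖
  rw [(sliceCov_isHermitian T k).l2_opNorm_eq_norm_eigenvalues]
  have hbdd : BddAbove (Set.range (sliceCov_isHermitian T k).eigenvalues) :=
    (Set.finite_range _).bddAbove
  refine le_antisymm (ciSup_le fun j => ?_) ?_
  · exact (le_abs_self _).trans (norm_le_pi_norm (sliceCov_isHermitian T k).eigenvalues j)
  · refine (pi_norm_le_iff_of_nonneg
      ((sliceCov_eigenvalues_nonneg T k 0).trans (le_ciSup hbdd 0))).2 fun j => ?_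
    rw [Real.norm_of_nonneg (sliceCov_eigenvalues_nonneg T k j)]
    exact le_ciSup hbdd j

theorem topEigenvalue_nonneg (T : Tensor3 m₁ m₂ m₃) (k : Fin m₁) : 0 ≤ topEigenvalue T k :=
  Real.iSup_nonneg (sliceCov_eigenvalues_nonneg T k)

theorem topEigenvalue_le_maxTopEigenvalue (T : Tensor3 m₁ m₂ m₃) (k : Fin m₁) :
    topEigenvalue T k ≤ maxTopEigenvalue T :=
  le_ciSup (f := topEigenvalue T) (Set.finite_range _).bddAbove k

/-- The right side is the trace of the covariance, whose eigenvalues are nonnegative. -/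
theorem topEigenvalue_le_sum_sq [NeZero m₃] (T : Tensor3 m₁ m₂ m₃) (k : Fin m₁) :
    topEigenvalue T k ≤ ∑ i, ∑ j, T k i j ^ 2 := by
  have htr := (sliceCov_isHermitian T k).trace_eq_sum_eigenvalues
  have h : (sliceCov T k).trace = ∑ i, ∑ j, T k i j ^ 2 := by
    simp only [Matrix.trace, sliceCov, Matrix.diag_apply, Matrix.mul_apply, Matrix.transpose_apply]
    rw [Finset.sum_comm]
    simp [sq]
  rw [← h, htr]
  refine ciSup_le fun j => ?_
  exact Finset.single_le_sum (f := (sliceCov_isHermitian T k).eigenvalues)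
    (fun i _ => sliceCov_eigenvalues_nonneg T k i) (Finset.mem_univ j)

theorem Matrix.l2_opNorm_sq_le_sum_sq (X : Matrix (Fin m₂) (Fin m₃) ℝ) :
    ‖X‖ ^ 2 ≤ ∑ i, ∑ j, X i j ^ 2 := by
  rcases Nat.eq_zero_or_pos m₃ with rfl | h
  · have : X = 0 := by ext i j; exact j.elim0
    simp [this]
  · have : NeZero m₃ := ⟨h.ne'⟩
    have := topEigenvalue_le_sum_sq (m₁ := 1) (fun _ => X) 0
    rwa [topEigenvalue_eq_norm_sq] at this

theorem abs_le_l2_opNorm_of_rank_one (g : ℝ) (u : EuclideanSpace ℝ (Fin m₂))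
    (v : EuclideanSpace ℝ (Fin m₃)) (hu : ‖u‖ = 1) (hv : ‖v‖ = 1) :
    |g| ≤ ‖Matrix.of fun i j => g * u i * v j‖ := by
  have h := Matrix.l2_opNorm_mulVec (Matrix.of fun i j => g * u i * v j) v
  have hvv : ∑ j, v j * v j = 1 := by
    have := EuclideanSpace.real_norm_sq_eq v
    rw [hv] at this
    simpa [sq] using this.symm
  have : (WithLp.toLp 2 ((Matrix.of fun i j => g * u i * v j).mulVec v) :
      EuclideanSpace ℝ (Fin m₂)) = g • u := by
    ext i
    simp [Matrix.mulVec, dotProduct, mul_assoc, ← Finset.mul_sum, hvv]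
  simpa [this, norm_smul, hu, hv] using h

theorem sum_sq_rank_one (g : ℝ) (u : EuclideanSpace ℝ (Fin m₂))
    (v : EuclideanSpace ℝ (Fin m₃)) (hu : ‖u‖ = 1) (hv : ‖v‖ = 1) :
    ∑ i, ∑ j, (g * u i * v j) ^ 2 = g ^ 2 := by
  have h₁ := EuclideanSpace.real_norm_sq_eq u
  have h₂ := EuclideanSpace.real_norm_sq_eq v
  simp only [mul_pow, ← Finset.mul_sum, ← Finset.sum_mul, ← h₁, ← h₂, hu, hv]
  simp

end SpectralNorm

/-! ### The algorithm on two separated groups of values -/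

section Algorithm

variable {m : ℕ} {d : Fin m → ℝ} {I : Finset (Fin m)}

theorem exists_isMSCInit (d : Fin m → ℝ) (hm : 1 < m) : ∃ J, IsMSCInit d J := by
  let σ := Tuple.sort d
  have hne : (Finset.univ : Finset (Fin (m - 1))).Nonempty := ⟨⟨0, by omega⟩, Finset.mem_univ _⟩
  obtain ⟨p, -, hp⟩ := Finset.exists_max_image Finset.univ
    (fun q : Fin (m - 1) => d (σ ⟨q + 1, by omega⟩) - d (σ ⟨q, by omega⟩)) hne
  refine ⟨Finset.univ.filter fun i => p < (σ.symm i : ℕ), σ, Tuple.monotone_sort d, p, by omega,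
    fun q hq => hp ⟨q, by omega⟩ (Finset.mem_univ _), fun i => by simp⟩

/-- If the values of `d` on `I` and off `I` lie in two intervals of length `δ` that are more than
`δ` apart, then the initialization of the procedure is `I`. -/
theorem isMSCInit_iff_of_separated (hI : I.Nonempty) (hIc : Iᶜ.Nonempty) {α β δ : ℝ}
    (hoff : ∀ k ∉ I, α ≤ d k ∧ d k ≤ α + δ) (hon : ∀ k ∈ I, β ≤ d k ∧ d k ≤ β + δ)
    (hsep : α + 2 * δ < β) (J : Finset (Fin m)) : IsMSCInit d J ↔ J = I := by
  have key : ∀ J, IsMSCInit d J → J = I := by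
    rintro J ⟨σ, hσ, p, hp, hmax, hJ⟩
    obtain ⟨a, ha⟩ := hI
    obtain ⟨b, hb⟩ := hIc
    rw [Finset.mem_compl] at hb
    have hδ : 0 ≤ δ := by linarith [hoff b hb]
    have hlt : ∀ k ∉ I, ∀ i ∈ I, d k < d i := fun k hk i hi => by
      linarith [hoff k hk, hon i hi]
    -- a crossing position
    obtain ⟨q, hq, hq₁, hq₂⟩ : ∃ (q : ℕ) (hq : q + 1 < m),
        σ ⟨q, by omega⟩ ∉ I ∧ σ ⟨q + 1, hq⟩ ∈ I := by
      -- Without a crossing, the sorted sequence would stay outside `I` from the position of `b`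
      -- upwards and so never reach `a`, which is sorted after `b`.
      by_contra! hcon
      have hall : ∀ (n : ℕ) (hn : (σ.symm b : ℕ) + n < m), σ ⟨σ.symm b + n, hn⟩ ∉ I := by
        intro n
        induction n with
        | zero => intro hn; simpa using hb
        | succ n ih => intro hn; exact hcon _ hn (ih (by omega))
      have hba : σ.symm b ≤ σ.symm a := by
        by_contra! h
        have := hσ h.le
        simp only [Function.comp_apply, Equiv.apply_symm_apply] at this
        linarith [hlt b hb a ha]
      have := hall (σ.symm a - σ.symm b) (by have := (σ.symm a).2; omega)
      have hEq : (⟨(σ.symm b : ℕ) + (σ.symm a - σ.symm b), by have := (σ.symm a).2; omega⟩ :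
          Fin m) = σ.symm a := Fin.ext (by simp only [Fin.le_def] at hba; simp; omega)
      rw [hEq, Equiv.apply_symm_apply] at this
      exact this ha
    -- The crossing gap is at least β - (α + δ) > δ, hence so is the largest one; two values on the
    -- same side differ by at most δ, so the largest gap is itself a crossing.
    have hgap : δ < d (σ ⟨p + 1, hp⟩) - d (σ ⟨p, by omega⟩) := by
      have h := hmax q hq
      linarith [hoff _ hq₁, hon _ hq₂]
    have hstep : d (σ ⟨p, by omega⟩) ≤ d (σ ⟨p + 1, hp⟩) :=
      hσ (show (⟨p, by omega⟩ : Fin m) ≤ ⟨p + 1, hp⟩ by simp [Fin.le_def])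
    have hp₁ : σ ⟨p, by omega⟩ ∉ I := by
      intro h
      by_cases h' : σ ⟨p + 1, hp⟩ ∈ I
      · linarith [hon _ h, hon _ h']
      · linarith [hlt _ h' _ h]
    have hp₂ : σ ⟨p + 1, hp⟩ ∈ I := by
      by_contra h
      linarith [hoff _ h, hoff _ hp₁]
    ext i
    rw [hJ]
    constructor
    · intro hi
      by_contra h
      have := hσ (show (⟨p + 1, hp⟩ : Fin m) ≤ σ.symm i by rw [Fin.le_def]; exact hi)
      simp only [Function.comp_apply, Equiv.apply_symm_apply] at this
      linarith [hlt i h _ hp₂]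
    · intro hi
      by_contra! h
      have := hσ (show σ.symm i ≤ (⟨p, by omega⟩ : Fin m) by rw [Fin.le_def]; exact h)
      simp only [Function.comp_apply, Equiv.apply_symm_apply] at this
      linarith [hlt _ hp₁ i hi]
  refine ⟨key J, ?_⟩
  rintro rfl
  have hm : 1 < m := by
    have h₁ := Finset.card_add_card_compl J
    have h₂ := hI.card_pos
    have h₃ := hIc.card_pos
    simp only [Fintype.card_fin] at h₁
    omega
  obtain ⟨J', hJ'⟩ := exists_isMSCInit d hm
  rwa [← key J' hJ']

/-- The initialization is already free of violations, so no step of the loop is possible. -/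
theorem isMSCOutput_iff_of_isMSCInit_iff {ε : ℝ} (hinit : ∀ J, IsMSCInit d J ↔ J = I)
    (hI : ∀ i ∈ I, ∀ n ∈ I, |d i - d n| ≤ mscBound m ε I.card) (K : Finset (Fin m)) :
    IsMSCOutput d ε K ↔ K = I := by
  have hviol : ∀ i, ¬ MSCViolates d ε I i := by
    rintro i ⟨hi, n, hn, hlt⟩
    exact absurd (hI i hi n hn) hlt.not_ge
  constructor
  · rintro ⟨J₀, h₀, hred, -⟩
    rw [hinit] at h₀
    subst h₀
    rcases hred.cases_head with h | ⟨J', ⟨i, hi, -⟩, -⟩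
    · exact h.symm
    · exact absurd hi (hviol i)
  · rintro rfl
    exact ⟨K, (hinit K).2 rfl, Relation.ReflTransGen.refl, hviol⟩

end Algorithm

/-! ### Moment bounds for quadratic functions of Gaussian vectors -/

section GaussianMoments

/-- The standard Gaussian measure on `ι → ℝ`. -/
noncomputable abbrev stdGaussianPi (ι : Type*) [Fintype ι] : Measure (ι → ℝ) :=
  Measure.pi fun _ => gaussianReal 0 1

theorem integrable_pow_gaussianReal (n : ℕ) : Integrable (fun t : ℝ => t ^ n) (gaussianReal 0 1) :=
  (memLp_id_gaussianReal (μ := 0) (v := 1) n).integrable_norm_pow'.mono' (by fun_prop)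
    (ae_of_all _ fun t => by simp)

theorem integral_sq_gaussianReal : ∫ t : ℝ, t ^ 2 ∂gaussianReal 0 1 = 1 := by
  have h := variance_fun_id_gaussianReal (μ := 0) (v := 1)
  rw [variance_eq_integral (by fun_prop)] at h
  simpa using h

/-- A constant `≥ 1` bounding twice the variance of the square of a standard normal variable. -/
noncomputable def gaussianSqConst : ℝ := 1 + 2 * ∫ t : ℝ, (t ^ 2 - 1) ^ 2 ∂gaussianReal 0 1

theorem one_le_gaussianSqConst : 1 ≤ gaussianSqConst := by
  have : 0 ≤ ∫ t : ℝ, (t ^ 2 - 1) ^ 2 ∂gaussianReal 0 1 := integral_nonneg fun t => sq_nonneg _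
  unfold gaussianSqConst
  linarith

theorem memLp_mul_add_gaussianReal (a : ℝ) :
    MemLp (fun t : ℝ => t * (a + t)) 2 (gaussianReal 0 1) := by
  rw [memLp_two_iff_integrable_sq (by fun_prop)]
  have : (fun t : ℝ => (t * (a + t)) ^ 2) =
      fun t => a ^ 2 * t ^ 2 + 2 * a * t ^ 3 + t ^ 4 := by ext t; ring
  rw [this]
  exact (((integrable_pow_gaussianReal 2).const_mul _).add
    ((integrable_pow_gaussianReal 3).const_mul _)).add (integrable_pow_gaussianReal 4)

theorem integral_mul_add_gaussianReal (a : ℝ) :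
    ∫ t : ℝ, t * (a + t) ∂gaussianReal 0 1 = 1 := by
  have h₁ : Integrable (fun t : ℝ => t) (gaussianReal 0 1) := by
    simpa using integrable_pow_gaussianReal 1
  have : (fun t : ℝ => t * (a + t)) = fun t => a * t + t ^ 2 := by ext t; ring
  rw [this, integral_add (h₁.const_mul a) (integrable_pow_gaussianReal 2), integral_const_mul,
    integral_sq_gaussianReal, integral_id_gaussianReal]
  simp

/-- Since t(a + t) - 1 = (t² - 1) + at, this is (x + y)² ≤ 2x² + 2y². The variable t(a + t) is the
term linear in τ of the exponent in `contractionDensity`. -/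
theorem variance_mul_add_gaussianReal_le (a : ℝ) :
    Var[fun t : ℝ => t * (a + t); gaussianReal 0 1] ≤ gaussianSqConst + 2 * a ^ 2 := by
  rw [variance_eq_integral (by fun_prop), integral_mul_add_gaussianReal]
  have h₄ : Integrable (fun t : ℝ => (t ^ 2 - 1) ^ 2) (gaussianReal 0 1) := by
    have : (fun t : ℝ => (t ^ 2 - 1) ^ 2) = fun t => t ^ 4 - 2 * t ^ 2 + 1 := by ext t; ring
    rw [this]
    exact ((integrable_pow_gaussianReal 4).sub
      ((integrable_pow_gaussianReal 2).const_mul _)).add (integrable_const _)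
  calc ∫ t : ℝ, (t * (a + t) - 1) ^ 2 ∂gaussianReal 0 1
      ≤ ∫ t : ℝ, 2 * (t ^ 2 - 1) ^ 2 + 2 * a ^ 2 * t ^ 2 ∂gaussianReal 0 1 := by
        refine integral_mono_of_nonneg (ae_of_all _ fun t => sq_nonneg _)
          ((h₄.const_mul 2).add ((integrable_pow_gaussianReal 2).const_mul _))
          (ae_of_all _ fun t => ?_)
        dsimp only
        nlinarith [sq_nonneg ((t ^ 2 - 1) - a * t)]
    _ = 2 * (∫ t : ℝ, (t ^ 2 - 1) ^ 2 ∂gaussianReal 0 1) + 2 * a ^ 2 := by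
        rw [integral_add (h₄.const_mul 2) ((integrable_pow_gaussianReal 2).const_mul _),
          integral_const_mul, integral_const_mul, integral_sq_gaussianReal, mul_one]
    _ ≤ gaussianSqConst + 2 * a ^ 2 := by unfold gaussianSqConst; linarith

variable {ι : Type*} [Fintype ι]

theorem measureReal_sum_sq_add_ge_le (S : Finset ι) (M : ι → ℝ) {a : ℝ} (ha : 0 < a) :
    (stdGaussianPi ι).real {z | a ≤ ∑ q ∈ S, (M q + z q) ^ 2} ≤
      (S.card + ∑ q ∈ S, M q ^ 2) / a := by
  have h₁ : Integrable (fun t : ℝ => t) (gaussianReal 0 1) := by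
    simpa using integrable_pow_gaussianReal 1
  have hexp : ∀ b : ℝ, (fun t : ℝ => (b + t) ^ 2) = fun t => b ^ 2 + 2 * b * t + t ^ 2 := by
    intro b; ext t; ring
  have hint : ∀ b : ℝ, Integrable (fun t : ℝ => (b + t) ^ 2) (gaussianReal 0 1) := fun b => by
    rw [hexp]
    exact ((integrable_const _).add (h₁.const_mul _)).add (integrable_pow_gaussianReal 2)
  have hval : ∀ b : ℝ, ∫ t : ℝ, (b + t) ^ 2 ∂gaussianReal 0 1 = 1 + b ^ 2 := fun b => by
    have hadd : Integrable (fun t : ℝ => b ^ 2 + 2 * b * t) (gaussianReal 0 1) :=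
      (integrable_const _).add (h₁.const_mul _)
    rw [hexp, integral_add hadd (integrable_pow_gaussianReal 2),
      integral_add (integrable_const _) (h₁.const_mul _), integral_const_mul, integral_sq_gaussianReal, integral_id_gaussianReal]
    simp [add_comm]
  have hI : ∀ q ∈ S, Integrable (fun z : ι → ℝ => (M q + z q) ^ 2) (stdGaussianPi ι) :=
    fun q _ => (measurePreserving_eval (fun _ : ι => gaussianReal 0 1)
      q).integrable_comp_of_integrable (hint (M q))
  have h := mul_meas_ge_le_integral_of_nonneg (μ := stdGaussianPi ι)
    (ae_of_all _ fun z => Finset.sum_nonneg fun q _ => sq_nonneg (M q + z q))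
    (integrable_finsetSum S hI) a
  rw [integral_finsetSum S hI, Finset.sum_congr rfl fun q _ =>
    (integral_comp_eval (μ := fun _ : ι => gaussianReal 0 1) (i := q)
      (hint (M q)).aestronglyMeasurable).trans (hval (M q))] at h
  rw [le_div_iff₀' ha]
  simpa [Finset.sum_add_distrib] using h

theorem measureReal_sum_mul_add_ge_le [DecidableEq ι] (S : Finset ι) (M : ι → ℝ) {a : ℝ}
    (ha : 0 < a) :
    (stdGaussianPi ι).real {z | S.card + a ≤ ∑ q ∈ S, z q * (M q + z q)} ≤
      (gaussianSqConst * S.card + 2 * ∑ q ∈ S, M q ^ 2) / a ^ 2 := by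
  -- Extension by zero off `S` gives a sum over all coordinates, as `variance_sum_pi` requires.
  let g : ι → ℝ → ℝ := fun q t => if q ∈ S then t * (M q + t) else 0
  have hg : ∀ q, MemLp (g q) 2 (gaussianReal 0 1) := fun q => by
    by_cases hq : q ∈ S
    · simpa [g, hq] using memLp_mul_add_gaussianReal (M q)
    · simp [g, hq]
  have hgE : ∀ q, ∫ t, g q t ∂gaussianReal 0 1 = if q ∈ S then 1 else 0 := fun q => by
    by_cases hq : q ∈ S
    · simpa [g, hq] using integral_mul_add_gaussianReal (M q)
    · simp [g, hq]
  have hgV : ∀ q, Var[g q; gaussianReal 0 1] ≤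
      if q ∈ S then gaussianSqConst + 2 * M q ^ 2 else 0 := fun q => by
    by_cases hq : q ∈ S
    · simpa [g, hq] using variance_mul_add_gaussianReal_le (M q)
    · simp only [g, hq, if_false]
      exact (variance_zero (gaussianReal 0 1)).le
  let Y : (ι → ℝ) → ℝ := ∑ q, fun z => g q (z q)
  have hYq : ∀ q, MemLp (fun z : ι → ℝ => g q (z q)) 2 (stdGaussianPi ι) := fun q =>
    (hg q).comp_measurePreserving (measurePreserving_eval (fun _ : ι => gaussianReal 0 1) q)
  have hY : MemLp Y 2 (stdGaussianPi ι) := memLp_finsetSum' _ fun q _ => hYq q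
  have hYval : ∀ z, Y z = ∑ q ∈ S, z q * (M q + z q) := fun z => by
    simp [Y, g, Finset.sum_ite_mem]
  have hYE : ∫ z, Y z ∂stdGaussianPi ι = S.card := by
    simp only [Y, Finset.sum_apply]
    rw [integral_finsetSum _ fun q _ => (hYq q).integrable (by norm_num)]
    rw [Finset.sum_congr rfl fun q _ =>
      (integral_comp_eval (μ := fun _ : ι => gaussianReal 0 1) (i := q)
        (hg q).aestronglyMeasurable).trans (hgE q)]
    simp
  have hYV : Var[Y; stdGaussianPi ι] ≤ gaussianSqConst * S.card + 2 * ∑ q ∈ S, M q ^ 2 := by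
    rw [variance_sum_pi hg]
    refine (Finset.sum_le_sum fun q _ => hgV q).trans (le_of_eq ?_)
    rw [Finset.sum_ite_mem, Finset.univ_inter, Finset.sum_add_distrib, ← Finset.mul_sum]
    simp [mul_comm]
  have h := meas_ge_le_variance_div_sq hY ha
  rw [hYE] at h
  have hnn : 0 ≤ Var[Y; stdGaussianPi ι] / a ^ 2 := div_nonneg (variance_nonneg _ _) (sq_nonneg _)
  calc (stdGaussianPi ι).real {z | S.card + a ≤ ∑ q ∈ S, z q * (M q + z q)}
      ≤ (stdGaussianPi ι).real {z | a ≤ |Y z - S.card|} := by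
        refine measureReal_mono fun z hz => ?_
        simp only [Set.mem_ofPred_eq, hYval] at hz ⊢
        exact le_trans (by linarith) (le_abs_self _)
    _ ≤ Var[Y; stdGaussianPi ι] / a ^ 2 := ENNReal.toReal_le_of_le_ofReal hnn h
    _ ≤ _ := by gcongr

end GaussianMoments

/-! ### Scaling of Gaussian measures and anti-concentration -/

section Scaling

/-- The density, with respect to the standard Gaussian measure, of its image under the contraction
`t ↦ (t - τ * a) / (1 + τ)` towards `-a`. -/
noncomputable def contractionDensity (a τ t : ℝ) : ℝ :=
  Real.exp (Real.log (1 + τ) - τ * (t * (a + t)) - τ ^ 2 * (a + t) ^ 2 / 2)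

theorem gaussianReal_map_contraction (a : ℝ) {τ : ℝ} (hτ : 0 ≤ τ) :
    (gaussianReal 0 1).map (fun t => (t - τ * a) / (1 + τ)) =
      (gaussianReal 0 1).withDensity fun t => ENNReal.ofReal (contractionDensity a τ t) := by
  have hpos : 0 < 1 + τ := by linarith
  obtain ⟨v, hv⟩ : ∃ v : NNReal, (v : ℝ) = ((1 + τ) ^ 2)⁻¹ :=
    ⟨NNReal.mk _ (inv_nonneg.2 (sq_nonneg _)), rfl⟩
  have hmap : (gaussianReal 0 1).map (fun t => (t - τ * a) / (1 + τ)) =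
      gaussianReal (-(τ * a) / (1 + τ)) v := by
    rw [show (fun t : ℝ => (t - τ * a) / (1 + τ)) = (fun t => t / (1 + τ)) ∘ fun t => t - τ * a
      from rfl, ← Measure.map_map (by fun_prop) (by fun_prop), gaussianReal_map_sub_const,
      gaussianReal_map_div_const, zero_sub]
    congr 1
    ext
    rw [hv]
    simp
  have hv₀ : v ≠ 0 := by
    rw [ne_eq, ← NNReal.coe_eq_zero, hv]
    positivity
  rw [hmap, gaussianReal_of_var_ne_zero _ hv₀, gaussianReal_of_var_ne_zero _ one_ne_zero,
    ← withDensity_mul _ (by fun_prop) (by unfold contractionDensity; fun_prop)]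
  congr 1
  ext t
  simp only [gaussianPDF, Pi.mul_apply]
  rw [← ENNReal.ofReal_mul (gaussianPDFReal_nonneg _ _ _)]
  congr 1
  simp only [gaussianPDFReal, contractionDensity, hv, NNReal.coe_one, sub_zero, mul_one]
  have hsqrt : √(2 * Real.pi * ((1 + τ) ^ 2)⁻¹) = √(2 * Real.pi) * (1 + τ)⁻¹ := by
    rw [Real.sqrt_mul (by positivity), Real.sqrt_inv, Real.sqrt_sq hpos.le]
  have hs : √(2 * Real.pi) ≠ 0 := by positivity
  rw [hsqrt, mul_assoc _ (Real.exp _) (Real.exp _), ← Real.exp_add,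
    -- The inverse variance is (1 + τ)², and (1 + τ)(t + τa/(1 + τ)) = t + τ(a + t); expanding its
    -- square gives the exponent.
    show -t ^ 2 / 2 + (Real.log (1 + τ) - τ * (t * (a + t)) - τ ^ 2 * (a + t) ^ 2 / 2) =
      Real.log (1 + τ) + -(t - -(τ * a) / (1 + τ)) ^ 2 / (2 * ((1 + τ) ^ 2)⁻¹) by
        field_simp
        ring, Real.exp_add, Real.exp_log hpos]
  field_simp

variable {ι : Type*} [Fintype ι]

/-- It suffices to compare on boxes, where the indicator factorizes too and independence of the
coordinates splits the integral. -/
theorem withDensity_prod_pi (μ : ι → Measure ℝ) [∀ q, IsProbabilityMeasure (μ q)]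
    (f : ι → ℝ → ENNReal) (hf : ∀ q, Measurable (f q))
    [∀ q, IsProbabilityMeasure ((μ q).withDensity (f q))] :
    Measure.pi (fun q => (μ q).withDensity (f q)) =
      (Measure.pi μ).withDensity fun z => ∏ q, f q (z q) := by
  refine Measure.pi_eq fun s hs => ?_
  have hind : ∀ z : ι → ℝ, (Set.univ.pi s).indicator (fun z => ∏ q, f q (z q)) z =
      ∏ q, (s q).indicator (f q) (z q) := fun z => by
    by_cases hz : z ∈ Set.univ.pi s
    · rw [Set.indicator_of_mem hz]
      exact Finset.prod_congr rfl fun q _ => (Set.indicator_of_mem (hz q trivial) _).symm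
    · rw [Set.indicator_of_notMem hz]
      simp only [Set.mem_pi, not_forall] at hz
      obtain ⟨q, -, hq⟩ := hz
      exact (Finset.prod_eq_zero (Finset.mem_univ q) (Set.indicator_of_notMem hq _)).symm
  have hm : ∀ q, Measurable ((s q).indicator (f q)) := fun q => (hf q).indicator (hs q)
  have hindep : iIndepFun (fun (q : ι) (z : ι → ℝ) => (s q).indicator (f q) (z q))
      (Measure.pi μ) := iIndepFun_pi fun q => (hm q).aemeasurable
  rw [withDensity_apply _ (MeasurableSet.univ_pi hs),
    ← lintegral_indicator (MeasurableSet.univ_pi hs), lintegral_congr hind,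
    lintegral_prod_eq_prod_lintegral_of_indepFun Finset.univ _ hindep
      fun q => (hm q).comp (measurable_pi_apply q)]
  refine Finset.prod_congr rfl fun q _ => ?_
  rw [withDensity_apply _ (hs q), ← lintegral_indicator (hs q)]
  exact (measurePreserving_eval μ q).lintegral_comp (hm q)

section Contraction

variable {ι : Type*} [DecidableEq ι]

/-- The contraction by the factor `1 / (1 + τ)` towards `-M`, in the coordinates in `S`. -/
noncomputable def contraction (S : Finset ι) (M : ι → ℝ) (τ : ℝ) (z : ι → ℝ) : ι → ℝ :=
  fun q => (z q - (if q ∈ S then τ else 0) * M q) / (1 + if q ∈ S then τ else 0)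

theorem contraction_apply_of_notMem {S : Finset ι} (M : ι → ℝ) (τ : ℝ) (z : ι → ℝ) {q : ι}
    (hq : q ∉ S) : contraction S M τ z q = z q := by
  simp [contraction, hq]

theorem add_contraction_apply_of_mem {S : Finset ι} (M : ι → ℝ) {τ : ℝ} (hτ : 0 ≤ τ) (z : ι → ℝ)
    {q : ι} (hq : q ∈ S) : M q + contraction S M τ z q = (1 + τ)⁻¹ * (M q + z q) := by
  have : 1 + τ ≠ 0 := by positivity
  simp only [contraction, hq, if_true]
  field_simp
  ring

theorem measurable_contraction (S : Finset ι) (M : ι → ℝ) (τ : ℝ) :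
    Measurable (contraction S M τ) := by
  unfold contraction
  fun_prop

end Contraction

variable [DecidableEq ι]

theorem stdGaussianPi_map_contraction (S : Finset ι) (M : ι → ℝ) {τ : ℝ} (hτ : 0 ≤ τ) :
    (stdGaussianPi ι).map (contraction S M τ) = (stdGaussianPi ι).withDensity fun z =>
      ENNReal.ofReal (Real.exp (∑ q ∈ S, (Real.log (1 + τ) - τ * (z q * (M q + z q)) -
        τ ^ 2 * (M q + z q) ^ 2 / 2))) := by
  have hτ' : ∀ q, 0 ≤ if q ∈ S then τ else 0 := fun q => by split_ifs <;> simp [hτ]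
  have hmap := fun q => gaussianReal_map_contraction (M q) (hτ' q)
  have hprob : ∀ q, IsProbabilityMeasure ((gaussianReal 0 1).map fun t : ℝ =>
      (t - (if q ∈ S then τ else 0) * M q) / (1 + if q ∈ S then τ else 0)) := fun q =>
    Measure.isProbabilityMeasure_map (by fun_prop)
  have hprob' : ∀ q, IsProbabilityMeasure ((gaussianReal 0 1).withDensity fun t =>
      ENNReal.ofReal (contractionDensity (M q) (if q ∈ S then τ else 0) t)) := fun q =>
    hmap q ▸ hprob q
  unfold contraction
  rw [Measure.pi_map_pi (μ := fun _ : ι => gaussianReal 0 1)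
    (f := fun q t => (t - (if q ∈ S then τ else 0) * M q) / (1 + if q ∈ S then τ else 0))
    (by fun_prop), funext hmap, withDensity_prod_pi _ _
      (fun q => by unfold contractionDensity; fun_prop)]
  congr 1
  ext z
  unfold contractionDensity
  rw [← ENNReal.ofReal_prod_of_nonneg fun q _ => (Real.exp_pos _).le, ← Real.exp_sum,
    ← Finset.sum_subset (Finset.subset_univ S)]
  · congr 2
    exact Finset.sum_congr rfl fun q hq => by simp [hq]
  · intro q _ hq
    simp [hq]

theorem sub_sq_half_le_log_one_add {τ : ℝ} (hτ : 0 ≤ τ) : τ - τ ^ 2 / 2 ≤ Real.log (1 + τ) := by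
  refine le_trans ?_ (Real.le_log_one_add_of_nonneg hτ)
  rw [le_div_iff₀ (by positivity)]
  nlinarith [pow_nonneg hτ 3]

/-- Contracting a set by a small factor does not decrease its Gaussian measure by much, up to an
exceptional set. -/
theorem measureReal_inter_le_contraction (S : Finset ι) (M : ι → ℝ) {τ W : ℝ} (hτ : 0 ≤ τ)
    (hcard : (S.card : ℝ) ≤ W ^ 2) (hτW : τ * W ≤ 1) (hW : 0 ≤ W) {A : Set (ι → ℝ)}
    (hA : MeasurableSet A) :
    (stdGaussianPi ι).real (A ∩ {z | ∑ q ∈ S, z q * (M q + z q) ≤ S.card + W ∧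
      ∑ q ∈ S, (M q + z q) ^ 2 ≤ W ^ 2}) ≤
      Real.exp 2 * (stdGaussianPi ι).real (contraction S M τ ⁻¹' A) := by
  set G : Set (ι → ℝ) := {z | ∑ q ∈ S, z q * (M q + z q) ≤ S.card + W ∧
      ∑ q ∈ S, (M q + z q) ^ 2 ≤ W ^ 2}
  have hG : MeasurableSet G := by
    have h₁ : Measurable fun z : ι → ℝ => ∑ q ∈ S, z q * (M q + z q) := by fun_prop
    have h₂ : Measurable fun z : ι → ℝ => ∑ q ∈ S, (M q + z q) ^ 2 := by fun_prop
    exact (measurableSet_le h₁ measurable_const).inter (measurableSet_le h₂ measurable_const)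
  have hτ2 : τ ^ 2 * W ^ 2 ≤ 1 := by
    rw [← mul_pow]
    exact pow_le_one₀ (by positivity) hτW
  have hdens : ∀ z ∈ A ∩ G, ENNReal.ofReal (Real.exp (-2)) ≤
      ENNReal.ofReal (Real.exp (∑ q ∈ S, (Real.log (1 + τ) - τ * (z q * (M q + z q)) -
        τ ^ 2 * (M q + z q) ^ 2 / 2))) := by
    rintro z ⟨-, hz₁, hz₂⟩
    refine ENNReal.ofReal_le_ofReal (Real.exp_le_exp.2 ?_)
    have hlog := sub_sq_half_le_log_one_add hτ
    have e : ∑ q ∈ S, (Real.log (1 + τ) - τ * (z q * (M q + z q)) -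
        τ ^ 2 * (M q + z q) ^ 2 / 2) = S.card * Real.log (1 + τ) -
        τ * (∑ q ∈ S, z q * (M q + z q)) - τ ^ 2 / 2 * ∑ q ∈ S, (M q + z q) ^ 2 := by
      rw [Finset.sum_sub_distrib, Finset.sum_sub_distrib, Finset.mul_sum, Finset.mul_sum]
      simp only [Finset.sum_const, nsmul_eq_mul]
      congr 1
      exact Finset.sum_congr rfl fun q _ => by ring
    rw [e]
    -- The terms ±τ|S| cancel, as each z(M + z) has mean 1. What remains is at least -τ²|S|/2 - τW -
    -- τ²W²/2 ≥ -1/2 - 1 - 1/2.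
    have i₁ := mul_le_mul_of_nonneg_left hlog (Nat.cast_nonneg (α := ℝ) S.card)
    have i₂ := mul_le_mul_of_nonneg_left hz₁ hτ
    have i₃ := mul_le_mul_of_nonneg_left hz₂ (show 0 ≤ τ ^ 2 / 2 by positivity)
    have i₄ := mul_le_mul_of_nonneg_left hcard (show 0 ≤ τ ^ 2 / 2 by positivity)
    linarith
  have h : ENNReal.ofReal (Real.exp (-2)) * stdGaussianPi ι (A ∩ G) ≤
      stdGaussianPi ι (contraction S M τ ⁻¹' A) := by
    rw [← Measure.map_apply (measurable_contraction S M τ) hA,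
      stdGaussianPi_map_contraction S M hτ, withDensity_apply _ hA, ← setLIntegral_const]
    exact (setLIntegral_mono' (hA.inter hG) hdens).trans
      (lintegral_mono_set Set.inter_subset_left)
  have h' := ENNReal.toReal_mono (measure_ne_top _ _) h
  rw [ENNReal.toReal_mul, ENNReal.toReal_ofReal (Real.exp_pos _).le, Real.exp_neg,
    inv_mul_le_iff₀ (Real.exp_pos _)] at h'
  exact h'

/-- **Anti-concentration of homogeneous functions of a Gaussian vector.** If `F` is homogeneous in
`M + z` with respect to the coordinates in `S`, and `H` does not depend on these coordinates, then
`F` and `H` are unlikely to agree up to a factor close to `1`. -/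
theorem measureReal_abs_log_sub_log_le (S : Finset ι) (M : ι → ℝ) {F H : (ι → ℝ) → ℝ}
    (hF : Measurable F) (hH : Measurable H)
    (hFc : ∀ τ, 0 ≤ τ → ∀ z, F (contraction S M τ z) = (1 + τ)⁻¹ * F z)
    (hHc : ∀ τ, 0 ≤ τ → ∀ z, H (contraction S M τ z) = H z)
    {h L V : ℝ} (hh : 0 < h) (hL : 1 ≤ L) (hV : 0 < V)
    (hVM : gaussianSqConst * S.card + 2 * ∑ q ∈ S, M q ^ 2 ≤ V ^ 2) {K : ℕ} (hK : 0 < K)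
    (hKV : (Real.exp (3 * h * K) - 1) * (L * V) ≤ 1) :
    (stdGaussianPi ι).real {z | 0 < F z ∧ 0 < H z ∧ |Real.log (F z) - Real.log (H z)| ≤ h} ≤
      Real.exp 2 / K + 2 / L ^ 2 := by
  set A : Set (ι → ℝ) := {z | 0 < F z ∧ 0 < H z ∧ |Real.log (F z) - Real.log (H z)| ≤ h}
  have hA : MeasurableSet A :=
    (measurableSet_lt measurable_const hF).inter ((measurableSet_lt measurable_const hH).inter
      (measurableSet_le ((hF.log.sub hH.log).abs) measurable_const))
  set W := L * V
  have hW : 0 < W := by positivity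
  have hVW : V ^ 2 ≤ W ^ 2 := by
    have : V ≤ W := le_mul_of_one_le_left hV.le hL
    gcongr
  have hM₀ : 0 ≤ ∑ q ∈ S, M q ^ 2 := Finset.sum_nonneg fun q _ => sq_nonneg _
  have hcV : (S.card : ℝ) ≤ gaussianSqConst * S.card :=
    le_mul_of_one_le_left (Nat.cast_nonneg _) one_le_gaussianSqConst
  set G : Set (ι → ℝ) := {z | ∑ q ∈ S, z q * (M q + z q) ≤ S.card + W ∧
      ∑ q ∈ S, (M q + z q) ^ 2 ≤ W ^ 2}
  -- The choice 1 + τ_j = e^(3hj) lowers log F by 3hj. The steps exceed the width 2h of the window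
  -- for log F, so the preimages of `A` are disjoint.
  let τ : ℕ → ℝ := fun j => Real.exp (3 * h * j) - 1
  have hτ : ∀ j, 0 ≤ τ j := fun j => by
    have : 1 ≤ Real.exp (3 * h * j) := Real.one_le_exp (by positivity)
    simp only [τ]
    linarith
  have hAG : (K : ℝ) * (stdGaussianPi ι).real (A ∩ G) ≤ Real.exp 2 := by
    have hj : ∀ j ∈ Finset.range K, (stdGaussianPi ι).real (A ∩ G) ≤
        Real.exp 2 * (stdGaussianPi ι).real (contraction S M (τ j) ⁻¹' A) := by
      intro j hj
      refine measureReal_inter_le_contraction S M (hτ j) (by linarith) (le_trans ?_ hKV) hW.le hA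
      have : (j : ℝ) ≤ K := by exact_mod_cast (Finset.mem_range.1 hj).le
      simp only [τ]
      gcongr
    have hdisj : Set.PairwiseDisjoint (Finset.range K : Set ℕ)
        fun j => contraction S M (τ j) ⁻¹' A := by
      intro i _ j _ hij
      refine Set.disjoint_left.2 fun z hzi hzj => hij ?_
      have key : ∀ n, z ∈ contraction S M (τ n) ⁻¹' A →
          |Real.log (F z) - 3 * h * n - Real.log (H z)| ≤ h := by
        rintro n ⟨h₁, -, h₃⟩
        rw [hFc _ (hτ n)] at h₁ h₃
        have hexp : 1 + τ n = Real.exp (3 * h * n) := by simp [τ]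
        rw [hHc _ (hτ n), hexp, Real.log_mul (by positivity)
          (pos_of_mul_pos_right h₁ (by rw [hexp]; positivity)).ne', Real.log_inv, Real.log_exp] at h₃
        rwa [show Real.log (F z) - 3 * h * n - Real.log (H z) =
          -(3 * h * n) + Real.log (F z) - Real.log (H z) by ring]
      have h₁ := abs_le.1 (key i hzi)
      have h₂ := abs_le.1 (key j hzj)
      have h₃ : (i : ℝ) < j + 1 := by
        by_contra! hcon
        nlinarith
      have h₄ : (j : ℝ) < i + 1 := by
        by_contra! hcon
        nlinarith
      norm_cast at h₃ h₄
      omega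
    calc (K : ℝ) * (stdGaussianPi ι).real (A ∩ G)
        = ∑ j ∈ Finset.range K, (stdGaussianPi ι).real (A ∩ G) := by simp
      _ ≤ ∑ j ∈ Finset.range K,
          Real.exp 2 * (stdGaussianPi ι).real (contraction S M (τ j) ⁻¹' A) :=
        Finset.sum_le_sum hj
      _ = Real.exp 2 * (stdGaussianPi ι).real
          (⋃ j ∈ Finset.range K, contraction S M (τ j) ⁻¹' A) := by
        rw [← Finset.mul_sum, measureReal_biUnion_finset hdisj
          fun j _ => measurable_contraction S M (τ j) hA]
      _ ≤ Real.exp 2 * 1 := by gcongr; exact measureReal_le_one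
      _ = Real.exp 2 := mul_one _
  have hV0 : 0 < V ^ 2 := by positivity
  have hB₁ : (stdGaussianPi ι).real {z | S.card + W ≤ ∑ q ∈ S, z q * (M q + z q)} ≤ 1 / L ^ 2 := by
    refine (measureReal_sum_mul_add_ge_le S M hW).trans ?_
    rw [div_le_div_iff₀ (by positivity) (by positivity), one_mul, mul_pow, mul_comm (L ^ 2)]
    gcongr
  have hB₂ : (stdGaussianPi ι).real {z | W ^ 2 ≤ ∑ q ∈ S, (M q + z q) ^ 2} ≤ 1 / L ^ 2 := by
    refine (measureReal_sum_sq_add_ge_le S M (by positivity)).trans ?_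
    rw [div_le_div_iff₀ (by positivity) (by positivity), one_mul, mul_pow, mul_comm (L ^ 2)]
    gcongr
    linarith
  calc (stdGaussianPi ι).real A
      ≤ (stdGaussianPi ι).real ((A ∩ G) ∪ ({z | S.card + W ≤ ∑ q ∈ S, z q * (M q + z q)} ∪
          {z | W ^ 2 ≤ ∑ q ∈ S, (M q + z q) ^ 2})) := by
        refine measureReal_mono fun z hz => ?_
        by_cases h₁ : ∑ q ∈ S, z q * (M q + z q) ≤ S.card + W
        · by_cases h₂ : ∑ q ∈ S, (M q + z q) ^ 2 ≤ W ^ 2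
          · exact Or.inl ⟨hz, h₁, h₂⟩
          · exact Or.inr (Or.inr (not_le.1 h₂).le)
        · exact Or.inr (Or.inl (not_le.1 h₁).le)
    _ ≤ (stdGaussianPi ι).real (A ∩ G) + (1 / L ^ 2 + 1 / L ^ 2) := by
        refine (measureReal_union_le _ _).trans (add_le_add_right ?_ _)
        exact (measureReal_union_le _ _).trans (add_le_add hB₁ hB₂)
    _ ≤ Real.exp 2 / K + 2 / L ^ 2 := by
        have : (stdGaussianPi ι).real (A ∩ G) ≤ Real.exp 2 / K := by
          rw [le_div_iff₀' (by positivity)]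
          exact hAG
        have e : 1 / L ^ 2 + 1 / L ^ 2 = 2 / L ^ 2 := by ring
        linarith

end Scaling

/-! ### Sums of similarities in clusters of almost parallel vectors -/

section Clusters

open scoped InnerProductSpace

variable {E : Type*} [NormedAddCommGroup E] [InnerProductSpace ℝ E]

/-- With the sign of ⟨a, b⟩, ‖a ∓ b‖² ≤ 2 - 2|⟨a, b⟩| ≤ r²; the outer absolute values make the sign
harmless. -/
theorem abs_abs_inner_sub_abs_inner_le {a b : E} (ha : ‖a‖ ≤ 1) (hb : ‖b‖ ≤ 1) {r : ℝ}
    (hr : 0 ≤ r) (hab : 1 - r ^ 2 / 2 ≤ |⟪a, b⟫_ℝ|) (z : E) :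
    |(|⟪a, z⟫_ℝ| - |⟪b, z⟫_ℝ|)| ≤ r * ‖z‖ := by
  have ha' : ‖a‖ ^ 2 ≤ 1 := pow_le_one₀ (norm_nonneg _) ha
  have hb' : ‖b‖ ^ 2 ≤ 1 := pow_le_one₀ (norm_nonneg _) hb
  rcases le_total 0 ⟪a, b⟫_ℝ with h | h
  · rw [abs_of_nonneg h] at hab
    have hn : ‖a - b‖ ≤ r := by
      refine (pow_le_pow_iff_left₀ (norm_nonneg _) hr two_ne_zero).1 ?_
      rw [norm_sub_sq_real]
      linarith
    calc |(|⟪a, z⟫_ℝ| - |⟪b, z⟫_ℝ|)| ≤ |⟪a, z⟫_ℝ - ⟪b, z⟫_ℝ| := abs_abs_sub_abs_le _ _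
      _ = |⟪a - b, z⟫_ℝ| := by rw [inner_sub_left]
      _ ≤ ‖a - b‖ * ‖z‖ := abs_real_inner_le_norm _ _
      _ ≤ r * ‖z‖ := by gcongr
  · rw [abs_of_nonpos h] at hab
    have hn : ‖a + b‖ ≤ r := by
      refine (pow_le_pow_iff_left₀ (norm_nonneg _) hr two_ne_zero).1 ?_
      rw [norm_add_sq_real]
      linarith
    calc |(|⟪a, z⟫_ℝ| - |⟪b, z⟫_ℝ|)| = |(|⟪a, z⟫_ℝ| - |(-⟪b, z⟫_ℝ)|)| := by rw [abs_neg]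
      _ ≤ |⟪a, z⟫_ℝ - -⟪b, z⟫_ℝ| := abs_abs_sub_abs_le _ _
      _ = |⟪a + b, z⟫_ℝ| := by rw [inner_add_left, sub_neg_eq_add]
      _ ≤ ‖a + b‖ * ‖z‖ := abs_real_inner_le_norm _ _
      _ ≤ r * ‖z‖ := by gcongr

variable {κ : Type*} {y : κ → E}

theorem abs_real_inner_le_one (hy : ∀ k, ‖y k‖ ≤ 1) (i k : κ) : |⟪y i, y k⟫_ℝ| ≤ 1 :=
  (abs_real_inner_le_norm _ _).trans (mul_le_one₀ (hy i) (norm_nonneg _) (hy k))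

variable [DecidableEq κ]

/-- In two clusters of equal size, all the sums of similarities are close to each other. -/
theorem abs_sum_abs_inner_sub_le (hy : ∀ k, ‖y k‖ ≤ 1) {A B : Finset κ} (hAB : Disjoint A B)
    {l : ℕ} (hAl : A.card = l) (hBl : B.card = l) {r : ℝ} (hr : 0 ≤ r)
    (hA : ∀ i ∈ A, ∀ k ∈ A, 1 - r ^ 2 / 2 ≤ |⟪y i, y k⟫_ℝ|)
    (hB : ∀ i ∈ B, ∀ k ∈ B, 1 - r ^ 2 / 2 ≤ |⟪y i, y k⟫_ℝ|)
    {p q : κ} (hp : p ∈ A) (hq : q ∈ B) {i : κ} (hi : i ∈ A) :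
    |∑ k ∈ A ∪ B, |⟪y i, y k⟫_ℝ| - (l + l * |⟪y p, y q⟫_ℝ|)| ≤ l * (r ^ 2 / 2) + l * (2 * r) := by
  have h₁ : |∑ k ∈ A, (|⟪y i, y k⟫_ℝ| - 1)| ≤ l * (r ^ 2 / 2) := by
    refine (Finset.abs_sum_le_sum_abs _ _).trans ((Finset.sum_le_card_nsmul _ _ (r ^ 2 / 2)
      fun k hk => ?_).trans_eq (by simp [hAl]))
    rw [abs_le]
    constructor <;> linarith [hA i hi k hk, abs_real_inner_le_one hy i k, sq_nonneg r]
  have h₂ : |∑ k ∈ B, (|⟪y i, y k⟫_ℝ| - |⟪y p, y q⟫_ℝ|)| ≤ l * (2 * r) := by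
    refine (Finset.abs_sum_le_sum_abs _ _).trans ((Finset.sum_le_card_nsmul _ _ (2 * r)
      fun k hk => ?_).trans_eq (by simp [hBl]))
    -- Replace i by p inside `A`, then k by q inside `B`; each replacement costs at most r.
    have e₁ := abs_abs_inner_sub_abs_inner_le (hy i) (hy p) hr (hA i hi p hp) (y k)
    have e₂ := abs_abs_inner_sub_abs_inner_le (hy k) (hy q) hr (hB k hk q hq) (y p)
    rw [real_inner_comm (y p) (y k), real_inner_comm (y p) (y q)] at e₂
    calc |(|⟪y i, y k⟫_ℝ| - |⟪y p, y q⟫_ℝ|)|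
        ≤ |(|⟪y i, y k⟫_ℝ| - |⟪y p, y k⟫_ℝ|)| + |(|⟪y p, y k⟫_ℝ| - |⟪y p, y q⟫_ℝ|)| :=
          abs_sub_le _ _ _
      _ ≤ r * ‖y k‖ + r * ‖y p‖ := add_le_add e₁ e₂
      _ ≤ r * 1 + r * 1 := by gcongr <;> exact hy _
      _ = 2 * r := by ring
  have e : ∑ k ∈ A ∪ B, |⟪y i, y k⟫_ℝ| - (l + l * |⟪y p, y q⟫_ℝ|) =
      ∑ k ∈ A, (|⟪y i, y k⟫_ℝ| - 1) + ∑ k ∈ B, (|⟪y i, y k⟫_ℝ| - |⟪y p, y q⟫_ℝ|) := by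
    rw [Finset.sum_union hAB, Finset.sum_sub_distrib, Finset.sum_sub_distrib]
    simp only [Finset.sum_const, hAl, hBl, nsmul_eq_mul, mul_one]
    ring
  rw [e]
  exact (abs_add_le _ _).trans (add_le_add h₁ h₂)

variable [Fintype κ]

/-- The center D = l + l|⟨y_p, y_q⟩| is symmetric in the two clusters. Off them, ‖y i‖ is one of the
terms summed in `hσ`, so it is at most σ and multiplies everything. -/
theorem exists_marginal_center (hy : ∀ k, ‖y k‖ ≤ 1) {A B : Finset κ} (hAB : Disjoint A B)
    {l : ℕ} (hl : 0 < l) (hAl : A.card = l) (hBl : B.card = l) {r σ : ℝ} (hr : 0 ≤ r)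
    (hA : ∀ i ∈ A, ∀ k ∈ A, 1 - r ^ 2 / 2 ≤ |⟪y i, y k⟫_ℝ|)
    (hB : ∀ i ∈ B, ∀ k ∈ B, 1 - r ^ 2 / 2 ≤ |⟪y i, y k⟫_ℝ|)
    (hσ : ∑ k ∈ (A ∪ B)ᶜ, ‖y k‖ ≤ σ) :
    (∃ D, (l : ℝ) ≤ D ∧ ∀ i ∈ A ∪ B, D - (l * (r ^ 2 / 2) + l * (2 * r)) ≤ ∑ k, |⟪y i, y k⟫_ℝ| ∧
      ∑ k, |⟪y i, y k⟫_ℝ| ≤ D + (l * (r ^ 2 / 2) + l * (2 * r)) + σ) ∧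
    ∀ i ∉ A ∪ B, ∑ k, |⟪y i, y k⟫_ℝ| ≤ σ * (2 * l + σ) := by
  have hsplit : ∀ i, ∑ k, |⟪y i, y k⟫_ℝ| =
      ∑ k ∈ A ∪ B, |⟪y i, y k⟫_ℝ| + ∑ k ∈ (A ∪ B)ᶜ, |⟪y i, y k⟫_ℝ| := fun i =>
    (Finset.sum_add_sum_compl _ _).symm
  have hnoise : ∀ i, ∑ k ∈ (A ∪ B)ᶜ, |⟪y i, y k⟫_ℝ| ≤ ‖y i‖ * σ := fun i => by
    refine le_trans ?_ (mul_le_mul_of_nonneg_left hσ (norm_nonneg _))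
    rw [Finset.mul_sum]
    exact Finset.sum_le_sum fun k _ => abs_real_inner_le_norm _ _
  have hσ₀ : 0 ≤ σ := (Finset.sum_nonneg fun k _ => norm_nonneg (y k)).trans hσ
  obtain ⟨p, hp⟩ := Finset.card_pos.1 (hAl ▸ hl)
  obtain ⟨q, hq⟩ := Finset.card_pos.1 (hBl ▸ hl)
  refine ⟨⟨l + l * |⟪y p, y q⟫_ℝ|, le_add_of_nonneg_right (by positivity), fun i hi => ?_⟩,
    fun i hi => ?_⟩
  · have h₁ : |∑ k ∈ A ∪ B, |⟪y i, y k⟫_ℝ| - (l + l * |⟪y p, y q⟫_ℝ|)| ≤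
        l * (r ^ 2 / 2) + l * (2 * r) := by
      rcases Finset.mem_union.1 hi with hi | hi
      · exact abs_sum_abs_inner_sub_le hy hAB hAl hBl hr hA hB hp hq hi
      · rw [Finset.union_comm, ← real_inner_comm (y p)]
        exact abs_sum_abs_inner_sub_le hy hAB.symm hBl hAl hr hB hA hq hp hi
    have h₂ : 0 ≤ ∑ k ∈ (A ∪ B)ᶜ, |⟪y i, y k⟫_ℝ| := Finset.sum_nonneg fun k _ => abs_nonneg _
    have h₃ := (hnoise i).trans (mul_le_of_le_one_left hσ₀ (hy i))
    rw [abs_le] at h₁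
    rw [hsplit]
    constructor <;> linarith
  · have h₁ : ‖y i‖ ≤ σ := (Finset.single_le_sum (f := fun k => ‖y k‖)
      (fun k _ => norm_nonneg (y k)) (Finset.mem_compl.2 hi)).trans hσ
    have h₂ : ∑ k ∈ A ∪ B, |⟪y i, y k⟫_ℝ| ≤ ‖y i‖ * (2 * l) := by
      refine (Finset.sum_le_card_nsmul _ _ ‖y i‖ fun k _ => (abs_real_inner_le_norm _ _).trans
        (mul_le_of_le_one_right (norm_nonneg _) (hy k))).trans_eq ?_
      rw [Finset.card_union_of_disjoint hAB, hAl, hBl, nsmul_eq_mul]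
      push_cast
      ring
    calc ∑ k, |⟪y i, y k⟫_ℝ| ≤ ‖y i‖ * (2 * l + σ) := by
          rw [hsplit, mul_add]
          exact add_le_add h₂ (hnoise i)
      _ ≤ σ * (2 * l + σ) := by gcongr

end Clusters

/-! ### Deterministic recovery from small noise eigenvalues -/

section Tensor

variable {m₁ m₂ m₃ : ℕ}

theorem similarityMatrix_apply (T : Tensor3 m₁ m₂ m₃) (x : Fin m₁ → EuclideanSpace ℝ (Fin m₃))
    (i k : Fin m₁) : similarityMatrix T x i k =
      |inner ℝ ((topEigenvalue T i / maxTopEigenvalue T) • x i)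
        ((topEigenvalue T k / maxTopEigenvalue T) • x k)| := by
  simp only [similarityMatrix, dispersionMatrix, Matrix.map_apply, Matrix.mul_apply,
    Matrix.transpose_apply, Matrix.of_apply, PiLp.inner_apply, PiLp.smul_apply, smul_eq_mul,
    RCLike.inner_apply, conj_trivial]
  congr 1
  exact Finset.sum_congr rfl fun j _ => mul_comm _ _

theorem maxTopEigenvalue_nonneg (T : Tensor3 m₁ m₂ m₃) : 0 ≤ maxTopEigenvalue T :=
  Real.iSup_nonneg (topEigenvalue_nonneg T)

theorem norm_scaled_topEigenvector {T : Tensor3 m₁ m₂ m₃}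
    {x : Fin m₁ → EuclideanSpace ℝ (Fin m₃)} (hx : IsTopEigenvectors T x) (k : Fin m₁) :
    ‖(topEigenvalue T k / maxTopEigenvalue T) • x k‖ = topEigenvalue T k / maxTopEigenvalue T := by
  rw [norm_smul, (hx k).1, mul_one, Real.norm_of_nonneg
    (div_nonneg (topEigenvalue_nonneg T k) (maxTopEigenvalue_nonneg T))]

/-- The diagonal similarity is ρ² for a ratio ρ ∈ [0, 1], and ρ² ≤ ρ. -/
theorem IsSliceCluster.one_sub_le {T : Tensor3 m₁ m₂ m₃}
    {x : Fin m₁ → EuclideanSpace ℝ (Fin m₃)} (hx : IsTopEigenvectors T x) {ε : ℝ}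
    {J : Finset (Fin m₁)} (hJ : IsSliceCluster T x ε J) {i : Fin m₁} (hi : i ∈ J) :
    1 - ε / 2 ≤ topEigenvalue T i / maxTopEigenvalue T := by
  have h := hJ i hi i hi
  rw [similarityMatrix_apply, real_inner_self_eq_norm_sq, norm_scaled_topEigenvector hx,
    abs_of_nonneg (sq_nonneg _)] at h
  have h₀ := div_nonneg (topEigenvalue_nonneg T i) (maxTopEigenvalue_nonneg T)
  have h₁ := div_le_one_of_le₀ (topEigenvalue_le_maxTopEigenvalue T i) (maxTopEigenvalue_nonneg T)
  nlinarith

/-- If the top eigenvalues off two clusters of `l` slices are small, the multi-slice clustering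
procedure recovers the union of the two clusters. -/
theorem isMSCOutput_iff_of_sum_topEigenvalue_le {T : Tensor3 m₁ m₂ m₃}
    {x : Fin m₁ → EuclideanSpace ℝ (Fin m₃)} (hx : IsTopEigenvectors T x) {ε : ℝ} (hε : 0 < ε)
    {A B : Finset (Fin m₁)} (hAB : Disjoint A B) {l : ℕ} (hl : 0 < l) (hAl : A.card = l)
    (hBl : B.card = l) (hlm : 2 * l < m₁) (hεl : √ε ≤ 1 / ((m₁ : ℝ) - l))
    (hlog : 5 ≤ √(Real.log ((m₁ : ℝ) - 2 * l))) (hm : 100 ≤ (m₁ : ℝ) - 2 * l)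
    (hA : IsSliceCluster T x ε A) (hB : IsSliceCluster T x ε B)
    (hsum : ∑ k ∈ (A ∪ B)ᶜ, topEigenvalue T k ≤ maxTopEigenvalue T / 20) :
    (∀ i ∈ A ∪ B, ∀ n ∈ A ∪ B, |marginalSum T x i - marginalSum T x n| ≤
      (2 * l : ℝ) * (ε / 2) + √(Real.log ((m₁ : ℝ) - 2 * l))) ∧
    ∀ K, IsMSCOutput (marginalSum T x) ε K ↔ K = A ∪ B := by
  have hl1 : (1 : ℝ) ≤ l := by exact_mod_cast hl
  have hpos : (0 : ℝ) < m₁ - l := by linarith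
  have hr₀ : 0 ≤ √ε := Real.sqrt_nonneg _
  -- Here 2l < m₁ gives l ≤ m₁ - l.
  have hr₁ : √ε * l ≤ 1 := by
    rw [le_div_iff₀ hpos] at hεl
    nlinarith
  have hr₂ : √ε ≤ 1 / 100 := hεl.trans (one_div_le_one_div_of_le (by norm_num) (by linarith))
  have hsq : √ε ^ 2 = ε := Real.sq_sqrt hε.le
  let y : Fin m₁ → EuclideanSpace ℝ (Fin m₃) := fun k =>
    (topEigenvalue T k / maxTopEigenvalue T) • x k
  have hy : ∀ k, ‖y k‖ ≤ 1 := fun k => by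
    rw [norm_scaled_topEigenvector hx]
    exact div_le_one_of_le₀ (topEigenvalue_le_maxTopEigenvalue T k) (maxTopEigenvalue_nonneg T)
  have hσ : ∑ k ∈ (A ∪ B)ᶜ, ‖y k‖ ≤ 1 / 20 := by
    simp only [y, norm_scaled_topEigenvector hx, ← Finset.sum_div]
    exact div_le_of_le_mul₀ (maxTopEigenvalue_nonneg T) (by norm_num) (by linarith)
  have hA' : ∀ i ∈ A, ∀ k ∈ A, 1 - √ε ^ 2 / 2 ≤ |inner ℝ (y i) (y k)| := fun i hi k hk => by
    rw [hsq, ← similarityMatrix_apply]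
    exact hA i hi k hk
  have hB' : ∀ i ∈ B, ∀ k ∈ B, 1 - √ε ^ 2 / 2 ≤ |inner ℝ (y i) (y k)| := fun i hi k hk => by
    rw [hsq, ← similarityMatrix_apply]
    exact hB i hi k hk
  have hd : ∀ i, marginalSum T x i = ∑ k, |inner ℝ (y i) (y k)| := fun i =>
    Finset.sum_congr rfl fun k _ => similarityMatrix_apply T x i k
  obtain ⟨⟨D, hlD, hD⟩, hoff⟩ := exists_marginal_center hy hAB hl hAl hBl hr₀ hA' hB' hσ
  simp only [← hd, hsq] at hD hoff
  have hcard : (A ∪ B).card = 2 * l := by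
    rw [Finset.card_union_of_disjoint hAB, hAl, hBl, two_mul]
  have hbound : ∀ i ∈ A ∪ B, ∀ n ∈ A ∪ B, |marginalSum T x i - marginalSum T x n| ≤
      (2 * l : ℝ) * (ε / 2) + √(Real.log ((m₁ : ℝ) - 2 * l)) := by
    intro i hi n hn
    -- The spread around D is at most lε + 4l√ε + 1/20 ≤ lε + 5, and `hlog` absorbs the 5.
    have h₁ := hD i hi
    have h₂ := hD n hn
    rw [abs_le]
    constructor <;> nlinarith
  refine ⟨hbound, ?_⟩
  have hεs : ε ≤ 1 / 10000 := by
    rw [← hsq]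
    nlinarith
  have hεl' : ε * l ≤ l / 10000 := by nlinarith
  have hrl : √ε * l ≤ l / 100 := by nlinarith
  -- With δ = l/4: off the clusters d is at most (2l + 1/20)/20, on them the spread is at most lε +
  -- 4l√ε + 1/20, and D ≥ l leaves more than 2δ in between.
  refine isMSCOutput_iff_of_isMSCInit_iff (isMSCInit_iff_of_separated
    (α := 0) (β := D - (l * (ε / 2) + l * (2 * √ε))) (δ := l / 4) ?_ ?_ ?_ ?_ ?_) ?_
  · exact Finset.card_pos.1 (by omega)
  · refine Finset.card_pos.1 ?_
    rw [Finset.card_compl, Fintype.card_fin]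
    omega
  · intro k hk
    refine ⟨Finset.sum_nonneg fun j _ => ?_, (hoff k hk).trans (by linarith)⟩
    rw [similarityMatrix_apply]
    exact abs_nonneg _
  · intro k hk
    refine ⟨(hD k hk).1, (hD k hk).2.trans ?_⟩
    linarith
  · linarith
  · intro i hi n hn
    rw [mscBound, hcard]
    push_cast
    exact hbound i hi n hn

end Tensor

/-! ### Anti-concentration of the norms of noisy slices -/

section NoisyTensor

open scoped Matrix.Norms.L2Operator

variable {m₁ m₂ m₃ : ℕ}

/-- The sum of a tensor and of a tensor given by its family of entries. -/
def noisyTensor (S : Tensor3 m₁ m₂ m₃) (z : Fin m₁ × Fin m₂ × Fin m₃ → ℝ) : Tensor3 m₁ m₂ m₃ :=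
  fun k i j => S k i j + z (k, i, j)

/-- The positions of the entries of the slices in `I`. -/
def slicePositions (m₂ m₃ : ℕ) (I : Finset (Fin m₁)) : Finset (Fin m₁ × Fin m₂ × Fin m₃) :=
  I ×ˢ Finset.univ

theorem card_slicePositions (I : Finset (Fin m₁)) :
    (slicePositions m₂ m₃ I).card = I.card * (m₂ * m₃) := by
  simp [slicePositions]

theorem sum_slicePositions (I : Finset (Fin m₁)) (f : Fin m₁ × Fin m₂ × Fin m₃ → ℝ) :
    ∑ q ∈ slicePositions m₂ m₃ I, f q = ∑ k ∈ I, ∑ i, ∑ j, f (k, i, j) := by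
  simp only [slicePositions, Finset.sum_product, Fintype.sum_prod_type]

theorem measurable_norm_noisyTensor (S : Tensor3 m₁ m₂ m₃) (k : Fin m₁) :
    Measurable fun z => ‖noisyTensor S z k‖ := by
  refine Continuous.measurable (continuous_norm.comp (continuous_matrix fun i j => ?_))
  unfold noisyTensor
  fun_prop

theorem noisyTensor_contraction_of_mem (S : Tensor3 m₁ m₂ m₃) {I : Finset (Fin m₁)} {k : Fin m₁}
    (hk : k ∈ I) {τ : ℝ} (hτ : 0 ≤ τ) (z : Fin m₁ × Fin m₂ × Fin m₃ → ℝ) :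
    noisyTensor S (contraction (slicePositions m₂ m₃ I) (fun q => S q.1 q.2.1 q.2.2) τ z) k =
      (1 + τ)⁻¹ • noisyTensor S z k := by
  ext i j
  exact add_contraction_apply_of_mem (fun q : Fin m₁ × Fin m₂ × Fin m₃ => S q.1 q.2.1 q.2.2) hτ z
    (q := (k, i, j)) (by simp [slicePositions, hk])

theorem noisyTensor_contraction_of_notMem (S : Tensor3 m₁ m₂ m₃) {I : Finset (Fin m₁)}
    {k : Fin m₁} (hk : k ∉ I) (M : Fin m₁ × Fin m₂ × Fin m₃ → ℝ) (τ : ℝ)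
    (z : Fin m₁ × Fin m₂ × Fin m₃ → ℝ) :
    noisyTensor S (contraction (slicePositions m₂ m₃ I) M τ z) k = noisyTensor S z k := by
  ext i j
  simp only [noisyTensor]
  rw [contraction_apply_of_notMem M τ z (by simp [slicePositions, hk])]

theorem exp_sub_one_le_two_mul {x : ℝ} (h₀ : 0 ≤ x) (h₁ : x ≤ 1) : Real.exp x - 1 ≤ 2 * x := by
  have h := Real.abs_exp_sub_one_le (x := x) (by rwa [abs_of_nonneg h₀])
  rw [abs_of_nonneg h₀] at h
  exact (le_abs_self _).trans h

theorem exp_two_le_eight : Real.exp 2 ≤ 8 := by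
  have h := Real.exp_one_lt_d9
  have h₀ := Real.exp_pos 1
  rw [show (2 : ℝ) = 1 + 1 by norm_num, Real.exp_add]
  nlinarith

/-- Two different slices of a noisy tensor are unlikely to have almost the same norm. -/
theorem measureReal_abs_log_norm_sub_log_norm_le (S : Tensor3 m₁ m₂ m₃) {i n : Fin m₁}
    (hin : i ≠ n) {ε L V : ℝ} (hε : 0 < ε) (hL : 1 ≤ L) (hV : 1 ≤ V)
    (hSV : gaussianSqConst * (m₂ * m₃) + 2 * ∑ a, ∑ b, S i a b ^ 2 ≤ V ^ 2)
    (hεV : 6 * (ε * (L * V)) ≤ 1) :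
    (stdGaussianPi (Fin m₁ × Fin m₂ × Fin m₃)).real
      {z | 0 < ‖noisyTensor S z i‖ ∧ 0 < ‖noisyTensor S z n‖ ∧
        |Real.log ‖noisyTensor S z i‖ - Real.log ‖noisyTensor S z n‖| ≤ ε} ≤
      96 * (ε * (L * V)) + 2 / L ^ 2 := by
  set X := ε * (L * V) with hX
  have hX₀ : 0 < X := by positivity
  -- The largest K for which e^x - 1 ≤ 2x, with x = 3εK, yields the smallness condition `hKV`.
  let K := ⌊1 / (6 * X)⌋₊
  have hK : 1 ≤ K := by
    rw [Nat.le_floor_iff (by positivity), le_div_iff₀ (by positivity)]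
    simpa using hεV
  have hK' : (1 : ℝ) ≤ K := by exact_mod_cast hK
  have hKle : K * (6 * X) ≤ 1 := by
    have := Nat.floor_le (show 0 ≤ 1 / (6 * X) by positivity)
    rwa [le_div_iff₀ (by positivity)] at this
  have hKlt : 1 ≤ (K + 1 : ℝ) * (6 * X) := by
    have := (Nat.lt_floor_add_one (1 / (6 * X))).le
    rwa [div_le_iff₀ (by positivity)] at this
  have hεX : ε ≤ X := le_mul_of_one_le_right hε.le (one_le_mul_of_one_le_of_one_le hL hV)
  have hKV : (Real.exp (3 * ε * K) - 1) * (L * V) ≤ 1 := by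
    have h : 3 * ε * K ≤ 1 := by nlinarith
    have h₁ := exp_sub_one_le_two_mul (by positivity) h
    calc (Real.exp (3 * ε * K) - 1) * (L * V) ≤ 2 * (3 * ε * K) * (L * V) := by gcongr
      _ = K * (6 * X) := by rw [hX]; ring
      _ ≤ 1 := hKle
  have h := measureReal_abs_log_sub_log_le (slicePositions m₂ m₃ {i})
    (fun q => S q.1 q.2.1 q.2.2) (measurable_norm_noisyTensor S i)
    (measurable_norm_noisyTensor S n)
    (fun τ hτ z => by
      rw [noisyTensor_contraction_of_mem S (Finset.mem_singleton_self i) hτ, norm_smul,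
        Real.norm_of_nonneg (by positivity)])
    (fun τ _ z => by
      rw [noisyTensor_contraction_of_notMem S (by simpa using hin.symm)])
    hε hL (by linarith) (by rw [card_slicePositions, sum_slicePositions]; simpa using hSV) hK hKV
  refine h.trans (add_le_add_left ?_ _)
  -- From K + 1 ≤ 2K follows 1/K ≤ 12X, and e² ≤ 8 gives the constant 96 = 8 · 12.
  rw [div_le_iff₀ (by positivity)]
  nlinarith [exp_two_le_eight]

theorem topEigenvalue_noisyTensor_le_of_eq_zero [NeZero m₃] (S : Tensor3 m₁ m₂ m₃)
    (z : Fin m₁ × Fin m₂ × Fin m₃ → ℝ) {k : Fin m₁} (hk : S k = 0) :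
    topEigenvalue (noisyTensor S z) k ≤ ∑ i, ∑ j, z (k, i, j) ^ 2 := by
  refine (topEigenvalue_le_sum_sq _ k).trans_eq ?_
  simp [noisyTensor, hk]

theorem norm_slice_le (S : Tensor3 m₁ m₂ m₃) (z : Fin m₁ × Fin m₂ × Fin m₃ → ℝ) (k : Fin m₁)
    {a : ℝ} (ha : 0 ≤ a) (hz : ∑ i, ∑ j, z (k, i, j) ^ 2 ≤ a ^ 2) :
    ‖S k‖ ≤ ‖noisyTensor S z k‖ + a := by
  have h₁ : S k = noisyTensor S z k - Matrix.of fun i j => z (k, i, j) := by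
    ext i j
    simp [noisyTensor]
  have h₂ : ‖Matrix.of fun i j => z (k, i, j)‖ ≤ a :=
    (pow_le_pow_iff_left₀ (norm_nonneg _) ha two_ne_zero).1
      ((Matrix.l2_opNorm_sq_le_sum_sq _).trans hz)
  rw [h₁]
  exact (norm_sub_le _ _).trans (add_le_add_right h₂ _)

theorem pos_of_sq_pos {a : ℝ} (ha : 0 ≤ a) (h : 0 < a ^ 2) : 0 < a :=
  lt_of_le_of_ne ha (by rintro rfl; simp at h)

theorem abs_log_sub_log_le {F H lam ε : ℝ} (hF : 0 ≤ F) (hH : 0 ≤ H) (hε : 0 < ε) (hε₁ : ε ≤ 1)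
    (hlam : 0 < lam) (hF₁ : (1 - ε / 2) * lam ≤ F ^ 2) (hF₂ : F ^ 2 ≤ lam)
    (hH₁ : (1 - ε / 2) * lam ≤ H ^ 2) (hH₂ : H ^ 2 ≤ lam) :
    0 < F ∧ 0 < H ∧ |Real.log F - Real.log H| ≤ ε := by
  have hc : 0 < 1 - ε / 2 := by linarith
  have hF₀ : 0 < F ^ 2 := lt_of_lt_of_le (by positivity) hF₁
  have hH₀ : 0 < H ^ 2 := lt_of_lt_of_le (by positivity) hH₁
  have hlog : -ε ≤ Real.log (1 - ε / 2) := by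
    refine le_trans ?_ (Real.one_sub_inv_le_log_of_pos hc)
    rw [neg_le_sub_iff_le_add, inv_le_iff_one_le_mul₀ hc]
    nlinarith
  have a₁ := Real.log_le_log (by positivity) hF₁
  have a₂ := Real.log_le_log hF₀ hF₂
  have a₃ := Real.log_le_log (by positivity) hH₁
  have a₄ := Real.log_le_log hH₀ hH₂
  rw [Real.log_mul hc.ne' hlam.ne', Real.log_pow] at a₁ a₃
  rw [Real.log_pow] at a₂ a₄
  push_cast at a₁ a₂ a₃ a₄
  refine ⟨pos_of_sq_pos hF hF₀, pos_of_sq_pos hH hH₀, abs_le.2 ⟨?_, ?_⟩⟩ <;> linarith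

end NoisyTensor

/-! ### The exceptional event -/

section Recovery

open scoped Matrix.Norms.L2Operator

variable {m₁ m₂ m₃ : ℕ}

/-- The multi-slice clustering procedure recovers the union of two clusters of slices, as soon as
the noise slices are not too large in the mean, the noise in a slice `i` of the first cluster is not
too large, and this slice does not have almost the same norm as a slice `n` of the second one unless
its signal is large. -/
theorem isMSCOutput_noisyTensor [NeZero m₃] {S : Tensor3 m₁ m₂ m₃}
    {z : Fin m₁ × Fin m₂ × Fin m₃ → ℝ} {x : Fin m₁ → EuclideanSpace ℝ (Fin m₃)}
    (hx : IsTopEigenvectors (noisyTensor S z) x) {ε : ℝ} (hε : 0 < ε)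
    {A B : Finset (Fin m₁)} (hAB : Disjoint A B) {l : ℕ} (hl : 0 < l) (hAl : A.card = l)
    (hBl : B.card = l) (hlm : 2 * l < m₁) (hεl : √ε ≤ 1 / ((m₁ : ℝ) - l))
    (hlog : 5 ≤ √(Real.log ((m₁ : ℝ) - 2 * l))) (hm : 100 ≤ (m₁ : ℝ) - 2 * l)
    (hA : IsSliceCluster (noisyTensor S z) x ε A) (hB : IsSliceCluster (noisyTensor S z) x ε B)
    (hS : ∀ k ∉ A ∪ B, S k = 0) {i n : Fin m₁} (hi : i ∈ A) (hn : n ∈ B)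
    (hpos : 0 < maxTopEigenvalue (noisyTensor S z))
    {a b Γ : ℝ} (ha : 0 ≤ a) (hb : 0 ≤ b) (hΓ : b + a ≤ Γ)
    (hnoise : ∑ q ∈ slicePositions m₂ m₃ (A ∪ B)ᶜ, z q ^ 2 ≤ b ^ 2 / 20)
    (hslice : ∑ q ∈ slicePositions m₂ m₃ {i}, z q ^ 2 ≤ a ^ 2)
    (hsep : ‖S i‖ ≤ Γ → ¬ (0 < ‖noisyTensor S z i‖ ∧ 0 < ‖noisyTensor S z n‖ ∧
      |Real.log ‖noisyTensor S z i‖ - Real.log ‖noisyTensor S z n‖| ≤ ε)) :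
    (∀ i ∈ A ∪ B, ∀ n ∈ A ∪ B,
      |marginalSum (noisyTensor S z) x i - marginalSum (noisyTensor S z) x n| ≤
        (2 * l : ℝ) * (ε / 2) + √(Real.log ((m₁ : ℝ) - 2 * l))) ∧
    ∀ K, IsMSCOutput (marginalSum (noisyTensor S z) x) ε K ↔ K = A ∪ B := by
  rw [sum_slicePositions] at hnoise hslice
  rw [Finset.sum_singleton] at hslice
  refine isMSCOutput_iff_of_sum_topEigenvalue_le hx hε hAB hl hAl hBl hlm hεl hlog hm hA hB ?_
  refine (Finset.sum_le_sum fun k hk => topEigenvalue_noisyTensor_le_of_eq_zero S z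
    (hS k (Finset.mem_compl.1 hk))).trans (hnoise.trans ?_)
  -- Otherwise λ ≤ b², so slice i has norm at most b and its signal at most b + a ≤ Γ. Then `hsep`
  -- excludes the coincidence of norms that the two clusters force.
  by_contra! hlt
  have hlam : maxTopEigenvalue (noisyTensor S z) ≤ b ^ 2 := by linarith
  have hl1 : (1 : ℝ) ≤ l := by exact_mod_cast hl
  have hε₁ : ε ≤ 1 := by
    rw [← Real.sqrt_le_one]
    refine hεl.trans ?_
    rw [div_le_one₀ (by linarith)]
    linarith
  have hlow : ∀ {J : Finset (Fin m₁)} {k : Fin m₁}, k ∈ J →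
      IsSliceCluster (noisyTensor S z) x ε J →
      (1 - ε / 2) * maxTopEigenvalue (noisyTensor S z) ≤ ‖noisyTensor S z k‖ ^ 2 := by
    intro J k hk hJ
    rw [← topEigenvalue_eq_norm_sq, ← le_div_iff₀ hpos]
    exact hJ.one_sub_le hx hk
  have hup : ∀ k, ‖noisyTensor S z k‖ ^ 2 ≤ maxTopEigenvalue (noisyTensor S z) := fun k => by
    rw [← topEigenvalue_eq_norm_sq]
    exact topEigenvalue_le_maxTopEigenvalue _ k
  refine hsep ?_ (abs_log_sub_log_le (norm_nonneg _) (norm_nonneg _) hε hε₁ hpos (hlow hi hA)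
    (hup i) (hlow hn hB) (hup n))
  have h₁ := norm_slice_le S z i ha hslice
  have h₂ : ‖noisyTensor S z i‖ ≤ b :=
    (pow_le_pow_iff_left₀ (norm_nonneg _) hb two_ne_zero).1 ((hup i).trans hlam)
  linarith

theorem measureReal_sum_sq_ge_le (I : Finset (Fin m₁)) {a : ℝ} (ha : 0 < a) :
    (stdGaussianPi (Fin m₁ × Fin m₂ × Fin m₃)).real
      {z | a ≤ ∑ q ∈ slicePositions m₂ m₃ I, z q ^ 2} ≤ I.card * (m₂ * m₃) / a := by
  have h := measureReal_sum_sq_add_ge_le (slicePositions m₂ m₃ I)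
    (fun _ : Fin m₁ × Fin m₂ × Fin m₃ => (0 : ℝ)) ha
  simpa [card_slicePositions] using h

/-- The value of `N ^ (1 / 8)`, with `N` the number of noise slices, from which on the error bounds
for the recovery hold. -/
noncomputable def sizeThreshold (κ : ℝ) : ℝ := 1000 * (gaussianSqConst * (1 + κ) ^ 2)

theorem signalTensor_apply_of_mem (γ : Fin 2 → ℝ) (w : Fin 2 → EuclideanSpace ℝ (Fin m₁))
    (u : Fin 2 → EuclideanSpace ℝ (Fin m₂)) (v : Fin 2 → EuclideanSpace ℝ (Fin m₃))
    {k : Fin m₁} (hk : w 1 k = 0) :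
    signalTensor γ w u v k = Matrix.of fun i j => γ 0 * w 0 k * u 0 i * v 0 j := by
  ext i j
  simp [signalTensor, Fin.sum_univ_two, hk]

/-- On the first cluster the signal slices have rank at most one, so their Frobenius norm does not
exceed the operator norm. A bound on ‖S i‖ thus controls the signal term of the variance without a
dimensional factor. -/
theorem sum_sq_signalTensor_le (γ : Fin 2 → ℝ) (w : Fin 2 → EuclideanSpace ℝ (Fin m₁))
    (u : Fin 2 → EuclideanSpace ℝ (Fin m₂)) (v : Fin 2 → EuclideanSpace ℝ (Fin m₃))
    (hu : ‖u 0‖ = 1) (hv : ‖v 0‖ = 1) {k : Fin m₁} (hk : w 1 k = 0) :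
    ∑ a, ∑ b, signalTensor γ w u v k a b ^ 2 ≤ ‖signalTensor γ w u v k‖ ^ 2 := by
  rw [signalTensor_apply_of_mem γ w u v hk]
  simp only [Matrix.of_apply]
  rw [sum_sq_rank_one _ _ _ hu hv, ← sq_abs]
  exact pow_le_pow_left₀ (abs_nonneg _) (abs_le_l2_opNorm_of_rank_one _ _ _ hu hv) 2

theorem signalTensor_eq_zero (γ : Fin 2 → ℝ) (w : Fin 2 → EuclideanSpace ℝ (Fin m₁))
    (u : Fin 2 → EuclideanSpace ℝ (Fin m₂)) (v : Fin 2 → EuclideanSpace ℝ (Fin m₃))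
    {k : Fin m₁} (h₀ : w 0 k = 0) (h₁ : w 1 k = 0) : signalTensor γ w u v k = 0 := by
  ext i j
  simp [signalTensor, Fin.sum_univ_two, h₀, h₁]

theorem exists_ne_zero_of_norm_eq_one {l : ℕ} {w : EuclideanSpace ℝ (Fin l)} (hw : ‖w‖ = 1) :
    ∃ k, w k ≠ 0 := by
  by_contra! h
  have : w = 0 := by ext k; simpa using h k
  simp [this] at hw

theorem variance_scale_le {Q κ m t d : ℝ} (hQ : 1 ≤ Q) (hκ : 0 < κ) (hm : 0 < m) (ht : 1 ≤ t)
    (hd : d ≤ (κ * m) ^ 2) :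
    Q * d + 2 * ((1 + κ) * m * t ^ 5) ^ 2 ≤ (2 * (Q * (1 + κ)) * m * t ^ 5) ^ 2 := by
  set Γ := (1 + κ) * m * t ^ 5 with hΓ
  have h₁ : κ * m ≤ Γ := by
    have ht5 : 1 ≤ t ^ 5 := one_le_pow₀ ht
    have h : κ * m * 1 ≤ (1 + κ) * m * t ^ 5 := by
      gcongr
      linarith
    linarith
  have h₂ : 2 * (Q * (1 + κ)) * m * t ^ 5 = 2 * Q * Γ := by rw [hΓ]; ring
  have h₃ : Q * d ≤ Q * Γ ^ 2 := by
    gcongr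
    exact hd.trans (by gcongr)
  have h₄ : Q * Γ ^ 2 ≤ Q ^ 2 * Γ ^ 2 := by
    gcongr
    exact le_self_pow₀ hQ two_ne_zero
  have h₅ : 1 * Γ ^ 2 ≤ Q ^ 2 * Γ ^ 2 := by
    gcongr
    exact one_le_pow₀ hQ
  rw [h₂]
  linarith [show (2 * Q * Γ) ^ 2 = 4 * (Q ^ 2 * Γ ^ 2) by ring,
    show 0 ≤ Q ^ 2 * Γ ^ 2 by positivity]

/-- The threshold gives ε(m - l)² ≤ 1, hence εmt⁸ ≤ 2. The left side contains only t⁷, and the spare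
factor t absorbs the constant C. -/
theorem threshold_mul_scale_le {C m l t ε : ℝ} (hC : 0 < C) (ht : 0 < t) (hε : 0 < ε)
    (hεl : √ε ≤ 1 / (m - l)) (hml : t ^ 8 ≤ m - l) (hm : m ≤ 2 * (m - l)) (htC : 1000 * C ≤ t) :
    ε * (t * (2 * C * m * t ^ 5)) * t ≤ 4 / 1000 := by
  have hml₀ : 0 < m - l := lt_of_lt_of_le (by positivity) hml
  have hεm : ε * (m - l) ^ 2 ≤ 1 := by
    rw [le_div_iff₀ hml₀] at hεl
    have h := pow_le_one₀ (n := 2) (by positivity) hεl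
    rwa [mul_pow, Real.sq_sqrt hε.le] at h
  have h₁ : ε * m * t ^ 8 ≤ 2 := by
    calc ε * m * t ^ 8 ≤ ε * (2 * (m - l)) * (m - l) := by gcongr
      _ = 2 * (ε * (m - l) ^ 2) := by ring
      _ ≤ 2 := by linarith
  refine le_of_mul_le_mul_right ?_ ht
  calc ε * (t * (2 * C * m * t ^ 5)) * t * t = 2 * C * (ε * m * t ^ 8) := by ring
    _ ≤ 2 * C * 2 := by gcongr
    _ ≤ 4 / 1000 * t := by linarith

/-- Outside of an event of small probability, the multi-slice clustering procedure recovers the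
union of two clusters. -/
theorem exists_exceptional_set [NeZero m₂] [NeZero m₃] {κ t : ℝ} (hm₂ : (m₂ : ℝ) ≤ κ * m₁)
    (hm₃ : (m₃ : ℝ) ≤ κ * m₁) {S : Tensor3 m₁ m₂ m₃} {ε : ℝ} (hε : 0 < ε)
    {A B : Finset (Fin m₁)} (hAB : Disjoint A B) {l : ℕ} (hl : 0 < l) (hAl : A.card = l)
    (hBl : B.card = l) (hlm : 2 * l < m₁) (hεl : √ε ≤ 1 / ((m₁ : ℝ) - l))
    (hS : ∀ k ∉ A ∪ B, S k = 0) (hfrob : ∀ k ∈ A, ∑ a, ∑ b, S k a b ^ 2 ≤ ‖S k‖ ^ 2)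
    (htm : t ^ 8 = (m₁ : ℝ) - 2 * l) (ht : sizeThreshold κ ≤ t) :
    ∃ N : Set (Fin m₁ × Fin m₂ × Fin m₃ → ℝ),
      (stdGaussianPi (Fin m₁ × Fin m₂ × Fin m₃)).real N ≤ 3 / t ∧
      ∀ z ∉ N, ∀ x, IsTopEigenvectors (noisyTensor S z) x →
        0 < maxTopEigenvalue (noisyTensor S z) →
        IsSliceCluster (noisyTensor S z) x ε A → IsSliceCluster (noisyTensor S z) x ε B →
        (∀ i ∈ A ∪ B, ∀ n ∈ A ∪ B,
          |marginalSum (noisyTensor S z) x i - marginalSum (noisyTensor S z) x n| ≤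
            (2 * l : ℝ) * (ε / 2) + √(Real.log ((m₁ : ℝ) - 2 * l))) ∧
        ∀ K, IsMSCOutput (marginalSum (noisyTensor S z) x) ε K ↔ K = A ∪ B := by
  have hQ := one_le_gaussianSqConst
  have hl1 : (1 : ℝ) ≤ l := by exact_mod_cast hl
  have hm₂1 : (1 : ℝ) ≤ m₂ := by exact_mod_cast NeZero.one_le
  have hm₃1 : (1 : ℝ) ≤ m₃ := by exact_mod_cast NeZero.one_le
  have hlm' : (2 * l : ℝ) < m₁ := by exact_mod_cast hlm
  have hm₁ : (0 : ℝ) < m₁ := by linarith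
  have hκ : 0 < κ := pos_of_mul_pos_left (by linarith) hm₁.le
  set Q := gaussianSqConst
  have hC : 1 ≤ Q * (1 + κ) ^ 2 := by nlinarith [mul_pos hκ hκ]
  have ht₁ : 1000 ≤ t := by unfold sizeThreshold at ht; nlinarith
  have htκ : 20 * κ ^ 2 ≤ t := by unfold sizeThreshold at ht; nlinarith [mul_pos hκ hκ]
  have htC : 1000 * (Q * (1 + κ)) ≤ t := by
    unfold sizeThreshold at ht
    refine le_trans ?_ ht
    have : (1 + κ) ≤ (1 + κ) ^ 2 := by nlinarith
    gcongr
  have ht₀ : 0 < t := by linarith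
  set m : ℝ := (m₁ : ℝ) with hm_def
  have ht8 : 1000 ^ 8 ≤ t ^ 8 := by gcongr
  have hm100 : 100 ≤ m - 2 * l := by rw [← htm]; linarith
  have hlog : 5 ≤ √(Real.log (m - 2 * l)) := by
    refine Real.le_sqrt_of_sq_le ?_
    have h4 : 4 ≤ Real.log t := by
      rw [Real.le_log_iff_exp_le ht₀, show (4 : ℝ) = 2 + 2 by norm_num, Real.exp_add]
      nlinarith [exp_two_le_eight, Real.exp_pos 2]
    rw [← htm, Real.log_pow]
    push_cast
    linarith
  have hd : (m₂ * m₃ : ℝ) ≤ (κ * m) ^ 2 := by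
    rw [sq]
    gcongr
  -- With t⁸ noise slices, b² = t⁸ · m² · t² exceeds the expected noise energy by a factor of order
  -- t², and a² does so for a single slice. Γ ≥ a + b is the bound on the signal below which
  -- anti-concentration is used, and V = 2QΓ bounds the resulting standard deviation.
  set V := 2 * (Q * (1 + κ)) * m * t ^ 5 with hV
  set Γ := (1 + κ) * m * t ^ 5 with hΓ
  set a := κ * m * t with ha
  set b := m * t ^ 5 with hb
  obtain ⟨i, hi⟩ := Finset.card_pos.1 (hAl ▸ hl)
  obtain ⟨n, hn⟩ := Finset.card_pos.1 (hBl ▸ hl)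
  have hin : i ≠ n := fun h => Finset.disjoint_left.1 hAB hi (h ▸ hn)
  have ht5 : t ≤ t ^ 5 := le_self_pow₀ (by linarith) (by norm_num)
  have ha₀ : 0 < a := by positivity
  have hb₀ : 0 < b := by positivity
  have hΓ₀ : 0 < Γ := by positivity
  have hC₀ : 0 < Q * (1 + κ) := by positivity
  have hba : b + a ≤ Γ := by
    have : κ * m * t ≤ κ * m * t ^ 5 := by gcongr
    rw [hΓ, ha, hb]
    linarith
  have hVΓ : Q * (m₂ * m₃) + 2 * Γ ^ 2 ≤ V ^ 2 :=
    variance_scale_le hQ hκ hm₁ (by linarith) hd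
  have hV₁ : 1 ≤ V := by
    have h₁ : (1 : ℝ) ≤ Q * (m₂ * m₃) :=
      one_le_mul_of_one_le_of_one_le hQ (one_le_mul_of_one_le_of_one_le hm₂1 hm₃1)
    have hV₀ : 0 ≤ V := by positivity
    refine (one_le_sq_iff₀ hV₀).1 ?_
    linarith [sq_nonneg Γ]
  have hX : ε * (t * V) * t ≤ 4 / 1000 :=
    threshold_mul_scale_le hC₀ ht₀ hε hεl (by linarith) (by linarith) htC
  let N₁ : Set (Fin m₁ × Fin m₂ × Fin m₃ → ℝ) :=
    {z | b ^ 2 / 20 ≤ ∑ q ∈ slicePositions m₂ m₃ (A ∪ B)ᶜ, z q ^ 2}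
  let N₂ : Set (Fin m₁ × Fin m₂ × Fin m₃ → ℝ) :=
    {z | a ^ 2 ≤ ∑ q ∈ slicePositions m₂ m₃ {i}, z q ^ 2}
  let N₃ : Set (Fin m₁ × Fin m₂ × Fin m₃ → ℝ) :=
    {z | ‖S i‖ ≤ Γ ∧ (0 < ‖noisyTensor S z i‖ ∧ 0 < ‖noisyTensor S z n‖ ∧
      |Real.log ‖noisyTensor S z i‖ - Real.log ‖noisyTensor S z n‖| ≤ ε)}
  have hN₁ : (stdGaussianPi _).real N₁ ≤ 1 / t := by
    refine (measureReal_sum_sq_ge_le _ (by positivity)).trans ?_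
    have hcard : (((A ∪ B)ᶜ : Finset (Fin m₁)).card : ℝ) = t ^ 8 := by
      rw [Finset.card_compl, Fintype.card_fin, Finset.card_union_of_disjoint hAB, hAl, hBl,
        Nat.cast_sub (by omega), htm]
      push_cast
      ring
    rw [hcard, div_le_div_iff₀ (by positivity) ht₀]
    calc t ^ 8 * (m₂ * m₃) * t ≤ t ^ 8 * (κ * m) ^ 2 * t := by gcongr
      _ = κ ^ 2 * (m ^ 2 * t ^ 9) := by ring
      _ ≤ t / 20 * (m ^ 2 * t ^ 9) := by gcongr; linarith
      _ = 1 * (b ^ 2 / 20) := by rw [hb]; ring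
  have hN₂ : (stdGaussianPi _).real N₂ ≤ 1 / t := by
    refine (measureReal_sum_sq_ge_le _ (by positivity)).trans ?_
    rw [Finset.card_singleton, Nat.cast_one, one_mul, div_le_div_iff₀ (by positivity) ht₀]
    calc (m₂ * m₃ : ℝ) * t ≤ (κ * m) ^ 2 * t ^ 2 := by
          gcongr
          exact le_self_pow₀ (by linarith) (by norm_num)
      _ = 1 * a ^ 2 := by rw [ha]; ring
  have hN₃ : (stdGaussianPi _).real N₃ ≤ 1 / t := by
    -- For a larger signal `N₃` is empty, as the signal alone already makes λ large.
    by_cases hSi : ‖S i‖ ≤ Γ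
    · have hsq : ∑ a, ∑ b, S i a b ^ 2 ≤ Γ ^ 2 := (hfrob i hi).trans (by gcongr)
      have h := measureReal_abs_log_norm_sub_log_norm_le S hin hε (L := t) (V := V) (by linarith)
        hV₁ (le_trans (by gcongr) hVΓ) (by nlinarith)
      refine (measureReal_mono fun z hz => hz.2).trans (h.trans ?_)
      rw [le_div_iff₀ ht₀, add_mul]
      have : 2 / t ^ 2 * t ≤ 2 / 1000 := by
        rw [show 2 / t ^ 2 * t = 2 / t by field_simp]
        gcongr
      linarith
    · have : N₃ = ∅ := Set.eq_empty_of_forall_notMem fun z hz => hSi hz.1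
      rw [this, measureReal_empty]
      positivity
  refine ⟨N₁ ∪ (N₂ ∪ N₃), ?_, fun z hz x hx hpos hA hB => ?_⟩
  · refine (measureReal_union_le _ _).trans ?_
    have := measureReal_union_le (μ := stdGaussianPi (Fin m₁ × Fin m₂ × Fin m₃)) N₂ N₃
    linarith [show 3 / t = 1 / t + (1 / t + 1 / t) by ring]
  · simp only [Set.mem_union, not_or] at hz
    exact isMSCOutput_noisyTensor hx hε hAB hl hAl hBl hlm hεl hlog hm100 hA hB hS hi hn hpos
      ha₀.le hb₀.le hba (not_le.1 hz.1).le (not_le.1 hz.2.1).le fun h₁ h₂ => hz.2.2 ⟨h₁, h₂⟩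

end Recovery

/-! ### Transfer to the given probability space and choice of the exponent -/

theorem proposition1 (κ c : ℝ) (hc : 0 < c) :
    ∃ c₁ : ℝ, 0 < c₁ ∧
      ∀ (m₁ m₂ m₃ l : ℕ) (_ : (m₂ : ℝ) ≤ κ * m₁) (_ : (m₃ : ℝ) ≤ κ * m₁)
        -- the two rank-1 signals
        (γ : Fin 2 → ℝ) (w : Fin 2 → EuclideanSpace ℝ (Fin m₁))
        (u : Fin 2 → EuclideanSpace ℝ (Fin m₂)) (v : Fin 2 → EuclideanSpace ℝ (Fin m₃))
        (_ : ∀ a, 0 < γ a) (_ : ∀ a, ‖w a‖ = 1) (_ : ∀ a, ‖u a‖ = 1) (_ : ∀ a, ‖v a‖ = 1)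
        (_ : sliceSubspace (u 0) (v 0) ≠ sliceSubspace (u 1) (v 1))
        -- the two disjoint index sets of equal size that carry them
        (J : Fin 2 → Finset (Fin m₁)) (_ : ∀ a k, k ∈ J a ↔ w a k ≠ 0)
        (_ : Disjoint (J 0) (J 1)) (_ : ∀ a, (J a).card = l) (_ : 2 * l < m₁)
        -- the threshold
        (ε : ℝ) (_ : 0 < ε) (_ : √ε ≤ 1 / ((m₁ : ℝ) - l))
        -- the noise, with i.i.d. standard normal entries
        (Ω : Type*) (_ : MeasurableSpace Ω) (P : Measure Ω) (_ : IsProbabilityMeasure P)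
        (Z : Fin m₁ × Fin m₂ × Fin m₃ → Ω → ℝ)
        (_ : ∀ q, HasLaw (Z q) (gaussianReal 0 1) P) (_ : iIndepFun Z P)
        (T : Ω → Tensor3 m₁ m₂ m₃)
        (_ : ∀ ω k i j, T ω k i j = signalTensor γ w u v k i j + Z (k, i, j) ω),
        P {ω | ¬ ∀ x : Fin m₁ → EuclideanSpace ℝ (Fin m₃), IsTopEigenvectors (T ω) x →
            c * m₁ ≤ maxTopEigenvalue (T ω) →
            (∀ a, IsSliceCluster (T ω) x ε (J a)) →
            (∀ i ∈ J 0 ∪ J 1, ∀ n ∈ J 0 ∪ J 1,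
              |marginalSum (T ω) x i - marginalSum (T ω) x n| ≤
                (2 * l : ℝ) * (ε / 2) + √(Real.log ((m₁ : ℝ) - 2 * l))) ∧
            ∀ K, IsMSCOutput (marginalSum (T ω) x) ε K ↔ K = J 0 ∪ J 1} ≤
          ENNReal.ofReal (Real.exp 1 * ((m₁ : ℝ) - 2 * l) ^ (-c₁)) := by
  have hT₀ : 1000 ≤ |sizeThreshold κ| + 1000 := by linarith [abs_nonneg (sizeThreshold κ)]
  set t₀ : ℝ := |sizeThreshold κ| + 1000 with ht₀
  have hlog₀ : 0 < Real.log (t₀ ^ 8) := Real.log_pos (one_lt_pow₀ (by linarith) (by norm_num))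
  -- The second term makes e · N^(-c₁) ≥ 1 when N < t₀⁸, so the bound is trivial there. The first
  -- comes from 3/t ≤ t^(-1/2) = N^(-1/16) for larger N.
  refine ⟨min (1 / 16) (1 / Real.log (t₀ ^ 8)), by positivity, ?_⟩
  set c₁ : ℝ := min (1 / 16) (1 / Real.log (t₀ ^ 8))
  intro m₁ m₂ m₃ l hm₂ hm₃ γ w u v _ hw hu hv _ J hJ hdisj hcard hlm ε hε hεl Ω _ P _ Z hlaw hind T
    hT
  have hc₁ : 0 < c₁ := by positivity
  have hN : (1 : ℝ) ≤ m₁ - 2 * l := by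
    have : ((2 * l + 1 : ℕ) : ℝ) ≤ m₁ := by exact_mod_cast hlm
    push_cast at this
    linarith
  have hN₀ : (0 : ℝ) < m₁ - 2 * l := by linarith
  by_cases hsize : (m₁ : ℝ) - 2 * l < t₀ ^ 8
  · refine prob_le_one.trans ?_
    rw [ENNReal.one_le_ofReal, Real.rpow_def_of_pos hN₀, ← Real.exp_add]
    refine Real.one_le_exp ?_
    have h₁ : Real.log (m₁ - 2 * l) ≤ Real.log (t₀ ^ 8) := Real.log_le_log hN₀ hsize.le
    have h₂ : c₁ ≤ 1 / Real.log (t₀ ^ 8) := min_le_right _ _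
    have h₃ : Real.log (m₁ - 2 * l) * c₁ ≤ Real.log (t₀ ^ 8) * (1 / Real.log (t₀ ^ 8)) := by
      gcongr
    rw [mul_one_div_cancel hlog₀.ne'] at h₃
    linarith
  push Not at hsize
  obtain ⟨t, ht, ht₁⟩ : ∃ t : ℝ, t ^ 8 = (m₁ : ℝ) - 2 * l ∧ t₀ ≤ t := by
    have h : (((m₁ : ℝ) - 2 * l) ^ ((8 : ℕ) : ℝ)⁻¹) ^ 8 = (m₁ : ℝ) - 2 * l :=
      Real.rpow_inv_natCast_pow hN₀.le (by norm_num)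
    refine ⟨_, h, (pow_le_pow_iff_left₀ (by linarith) (by positivity) (n := 8) (by norm_num)).1 ?_⟩
    rw [h]
    exact hsize
  have ht_pos : 0 < t := by linarith
  have hw_ne := fun a => exists_ne_zero_of_norm_eq_one (hw a)
  have hm₂0 : NeZero m₂ := ⟨by
    obtain ⟨k, -⟩ := exists_ne_zero_of_norm_eq_one (hu 0)
    exact k.pos.ne'⟩
  have hm₃0 : NeZero m₃ := ⟨by
    obtain ⟨k, -⟩ := exists_ne_zero_of_norm_eq_one (hv 0)
    exact k.pos.ne'⟩
  have hl : 0 < l := by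
    obtain ⟨k, hk⟩ := hw_ne 0
    rw [← hcard 0]
    exact Finset.card_pos.2 ⟨k, (hJ 0 k).2 hk⟩
  have hS : ∀ k ∉ J 0 ∪ J 1, signalTensor γ w u v k = 0 := fun k hk => by
    simp only [Finset.mem_union, hJ, not_or, not_not] at hk
    exact signalTensor_eq_zero γ w u v hk.1 hk.2
  have hw1 : ∀ k ∈ J 0, w 1 k = 0 := fun k hk => by
    simpa [hJ] using Finset.disjoint_left.1 hdisj hk
  obtain ⟨N, hN3, hgood⟩ := exists_exceptional_set hm₂ hm₃ hε hdisj hl (hcard 0) (hcard 1) hlm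
    hεl hS (fun k hk => sum_sq_signalTensor_le γ w u v (hu 0) (hv 0) (hw1 k hk)) ht
    ((le_abs_self _).trans (by linarith))
  have hZ : ∀ q, AEMeasurable (Z q) P := fun q => (hlaw q).aemeasurable
  have hmap : P.map (fun ω q => Z q ω) = stdGaussianPi (Fin m₁ × Fin m₂ × Fin m₃) := by
    rw [(iIndepFun_iff_map_fun_eq_pi_map hZ).1 hind]
    exact congrArg Measure.pi (funext fun q => (hlaw q).map_eq)
  have hTn : ∀ ω, T ω = noisyTensor (signalTensor γ w u v) fun q => Z q ω := fun ω => by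
    ext k i j
    exact hT ω k i j
  calc _ ≤ P ((fun ω q => Z q ω) ⁻¹' N) := by
        refine measure_mono fun ω hω => ?_
        by_contra hNω
        refine hω fun x hx hlam hclust => ?_
        have hm₁ : (0 : ℝ) < m₁ := by
          have : (0 : ℝ) ≤ l := Nat.cast_nonneg l
          linarith
        -- Positivity is all that is needed of λ ≥ c m₁; the size of λ comes from
        -- anti-concentration.
        have hpos : 0 < maxTopEigenvalue (T ω) := lt_of_lt_of_le (by positivity) hlam
        have h₀ := hclust 0
        have h₁ := hclust 1
        rw [hTn] at hx hpos h₀ h₁ ⊢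
        exact hgood _ hNω x hx hpos h₀ h₁
    _ ≤ stdGaussianPi (Fin m₁ × Fin m₂ × Fin m₃) N :=
        -- This inequality needs no measurability of `N`.
        hmap ▸ Measure.le_map_apply (aemeasurable_pi_lambda _ hZ) N
    _ = ENNReal.ofReal ((stdGaussianPi (Fin m₁ × Fin m₂ × Fin m₃)).real N) :=
        (ofReal_measureReal).symm
    _ ≤ ENNReal.ofReal (Real.exp 1 * ((m₁ : ℝ) - 2 * l) ^ (-c₁)) := by
        refine ENNReal.ofReal_le_ofReal (hN3.trans ?_)
        have h₁ : ((m₁ : ℝ) - 2 * l) ^ (-(1 / 16) : ℝ) ≤ ((m₁ : ℝ) - 2 * l) ^ (-c₁) :=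
          Real.rpow_le_rpow_of_exponent_le hN (neg_le_neg (min_le_left _ _))
        have h₂ : ((m₁ : ℝ) - 2 * l) ^ (-(1 / 16) : ℝ) = (√t)⁻¹ := by
          rw [← ht, Real.sqrt_eq_rpow, ← Real.rpow_natCast, ← Real.rpow_mul ht_pos.le,
            ← Real.rpow_neg ht_pos.le]
          norm_num
        have h₃ : 3 / t ≤ (√t)⁻¹ := by
          have h3 : 3 ≤ √t := Real.le_sqrt_of_sq_le (by linarith)
          rw [div_le_iff₀ ht_pos, inv_mul_eq_div, Real.div_sqrt]
          exact h3
        have h₄ : 1 ≤ Real.exp 1 := Real.one_le_exp zero_le_one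
        have h₅ : 0 ≤ ((m₁ : ℝ) - 2 * l) ^ (-c₁) := Real.rpow_nonneg hN₀.le _
        nlinarith
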